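/- Definitions. An Ann-category is a category $\mathcal A$ with bifunctors $\oplus,\otimes$, where $(\mathcal A,\oplus,a^+,c^+,(0,g,d))$ is a symmetric categorical group (a symmetric monoidal groupoid in which every object is invertible up to isomorphism), $(\mathcal A,\otimes,a,(1,l,r))$ is a monoidal category, and natural isomorphisms $\mathfrak L:A(X\oplus Y)\to AX\oplus AY$ and $\mathfrak R:(X\oplus Y)A\to XA\oplus YA$ make $A\otimes-$ and $-\otimes A$ into $\oplus$-functors compatible with $a^+,c^+$, and are compatible with $a$, with $l,r$, and with each other up to the canonical exchange $(U\oplus V)\oplus(Z\oplus T)\to(U\oplus Z)\oplus(V\oplus T)$. It is braided if $\otimes$ has a braiding $c$ with $(c_{X,Y}\oplus c_{X,Z})\circ\mathfrak L=\mathfrak R\circ c_{X,Y\oplus Z}$ and $c_{0,0}=\mathrm{id}$. A braided Ann-functor $F$ is a functor that is symmetric monoidal for $\oplus$ and braided monoidal for $\otimes$, with structure isomorphisms $\breve F:FX\oplus FY\to F(X\oplus Y)$, $\widetilde F:FX\otimes FY\to F(XY)$, $F_*:1\to F1$, and that is compatible with $\mathfrak L$ and $\mathfrak R$. It is a braided Ann-equivalence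 if there are a braided Ann-functor $K$ in the other direction and isomorphisms $KF\cong\mathrm{id}$, $FK\cong\mathrm{id}$ that are monoidal for $\oplus$ and for $\otimes$. Let $\mathcal A$ be a braided Ann-category. $\pi_0\mathcal A$ is the commutative ring of isomorphism classes of objects, and $\pi_1\mathcal A=\mathrm{Aut}(0)$, written additively, is a $\pi_0\mathcal A$-module: $[X]\cdot u$ is defined by $([X]\cdot u)\circ\hat L^X=\hat L^X\circ(\mathrm{id}_X\otimes u)$, where $\hat L^X:X\otimes0\to0$ (and likewise $\hat R^X:0\otimes X\to 0$) is the isomorphism induced by the $\oplus$-functor $X\otimes-$ (respectively $-\otimes X$). For each object $X$, the bijection $\gamma_X:\pi_1\mathcal A\to\mathrm{Aut}(X)$ is determined by $g_X\circ(u\oplus\mathrm{id}_X)=\gamma_X(u)\circ g_X$. A stick of $\mathcal A$ consists of representatives $X_s\in s$ for $s\in\pi_0\mathcal A$, with $0$ and $1$ identified with $X_0$ and $X_1$ by chosen isomorphisms, and of isomorphisms $\varphi_{s,t}:X_s\oplus X_t\to X_{s+t}$ and $\psi_{s,t}:X_sX_t\to X_{st}$ such that, after these identifications, $\varphi_{0,t}=g$,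 $\varphi_{s,0}=d$, $\psi_{1,t}=l$, $\psi_{s,1}=r$, $\psi_{0,t}=\hat R^{X_t}$ and $\psi_{s,0}=\hat L^{X_s}$. The reduced category $s\mathcal A$ of a stick has the elements of $\pi_0\mathcal A$ as objects and the pairs $(s,u):s\to s$ with $u\in\pi_1\mathcal A$ as morphisms, composed by adding the second components. Its operations are $(s,u)\oplus(t,v)=(s+t,u+v)$ and $(s,u)\otimes(t,v)=(st,sv+tu)$. It is a braided Ann-category with the constraints for which the functor $H:s\mathcal A\to\mathcal A$, $H(s)=X_s$, $H(s,u)=\gamma_{X_s}(u)$, is a braided Ann-functor with structure isomorphisms $\varphi,\psi$ and the identifications. Given isomorphisms $i_X:X\to X_{[X]}$ with $i_{X_s}=\mathrm{id}$, the functor $G:\mathcal A\to s\mathcal A$, $G(X)=[X]$, $G(f)=([X],\gamma^{-1}_{X_{[X]}}(i_Yfi_X^{-1}))$ for $f:X\to Y$, is a braided Ann-functor with the structure for which the isomorphisms $i_X:X\to HGX$ are monoidal for $\oplus$ and for $\otimes$. Statement. Let $\mathcal A,\mathcal A'$ be braided Ann-categories and $F:\mathcal A\to\mathcal A'$ a braided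 Ann-functor. (a) $F_0:\pi_0\mathcal A\to\pi_0\mathcal A'$, $[X]\mapsto[FX]$, is a well-defined ring homomorphism, $F_1:\pi_1\mathcal A\to\pi_1\mathcal A'$, $u\mapsto\gamma_{F0}^{-1}(Fu)$, is a group homomorphism, and $F_1(su)=F_0(s)F_1(u)$ for all $s\in\pi_0\mathcal A$, $u\in\pi_1\mathcal A$. (b) For every stick of $\mathcal A$, every stick of $\mathcal A'$ and every family $(i'_Y)$ of isomorphisms as above for $\mathcal A'$, with associated functors $H:s\mathcal A\to\mathcal A$ and $G':\mathcal A'\to s\mathcal A'$, there is a braided Ann-functor $sF:s\mathcal A\to s\mathcal A'$ with $sF=G'\circ F\circ H$ as braided Ann-functors, and $sF$ is of type $(F_0,F_1)$: $sF(s)=F_0(s)$ and $sF(s,u)=(F_0(s),F_1(u))$. Here $H$ and $G'$ are braided Ann-equivalences. (c) $F$ is an equivalence if and only if $F_0$ and $F_1$ are isomorphisms. This holds both for "braided Ann-equivalence" and for "equivalence of the underlying categories". -/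

import Mathlib

open CategoryTheory MonoidalCategory

universe v u v₁ u₁ v₂ u₂ v₃ u₃

namespace BrAnn

/-- A monoidal category is a categorical group when every morphism is invertible and every
object is invertible for the tensor product, up to isomorphism. -/
class CatGroup (C : Type u) [Category.{v} C] [MonoidalCategory C] : Prop where
  isIso : ∀ {X Y : C} (f : X ⟶ Y), IsIso f
  exists_inverse : ∀ X : C, ∃ Y : C, Nonempty (X ⊗ Y ≅ 𝟙_ C) ∧ Nonempty (Y ⊗ X ≅ 𝟙_ C)

namespace CatGroup

section Generic

variable {C : Type u} [Category.{v} C] [MonoidalCategory C]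

theorem whiskerRight_bijective_of_iso {Z : C} (e : Z ≅ 𝟙_ C) (A B : C) :
    Function.Bijective (fun f : A ⟶ B => f ▷ Z) := by
  constructor
  · intro f g h
    have h' : f ▷ Z = g ▷ Z := h
    have : f ▷ (𝟙_ C) = g ▷ (𝟙_ C) := by
      rw [← cancel_epi (A ◁ e.hom), whisker_exchange, whisker_exchange, h']
    simpa using this
  · intro h
    refine ⟨(ρ_ A).inv ≫ A ◁ e.inv ≫ h ≫ B ◁ e.hom ≫ (ρ_ B).hom, ?_⟩
    rw [← cancel_mono (B ◁ e.hom)]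
    dsimp only
    rw [← whisker_exchange, whiskerRight_id]
    simp

theorem whiskerRight_bijective [CatGroup C] (A B Z : C) :
    Function.Bijective (fun f : A ⟶ B => f ▷ Z) := by
  have key : ∀ (A B Z W : C), Nonempty (Z ⊗ W ≅ 𝟙_ C) →
      Function.Bijective (fun f : A ⟶ B => (f ▷ Z) ▷ W) := by
    rintro A B Z W ⟨e⟩
    have h := whiskerRight_bijective_of_iso e A B
    have h2 : (fun f : A ⟶ B => (f ▷ Z) ▷ W) =
        (fun k : A ⊗ (Z ⊗ W) ⟶ B ⊗ (Z ⊗ W) => (α_ A Z W).hom ≫ k ≫ (α_ B Z W).inv) ∘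
          (fun f : A ⟶ B => f ▷ (Z ⊗ W)) := by
      funext f; simp
    rw [h2]
    refine Function.Bijective.comp ?_ h
    constructor
    · intro a b hab
      simpa using hab
    · intro k
      exact ⟨(α_ A Z W).inv ≫ k ≫ (α_ B Z W).hom, by simp⟩
  obtain ⟨W, h1, h2⟩ := exists_inverse Z
  constructor
  · intro f g h
    apply (key A B Z W h1).1
    exact congrArg (fun k => k ▷ W) h
  · intro h
    obtain ⟨f, hf⟩ := (key A B Z W h1).2 (h ▷ W)
    refine ⟨f, ?_⟩
    have inj : Function.Injective (fun f : A ⊗ Z ⟶ B ⊗ Z => f ▷ W) := by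
      intro f g h
      apply (key (A ⊗ Z) (B ⊗ Z) W Z h2).1
      exact congrArg (fun k => k ▷ Z) h
    exact inj hf

/-- The endomorphism of `X` induced by an endomorphism `u` of the unit, i.e. the unique one making
the square with the left unit constraint and `u ⊗ id` commute. -/
def act (X : C) (u : 𝟙_ C ⟶ 𝟙_ C) : X ⟶ X := (λ_ X).inv ≫ u ▷ X ≫ (λ_ X).hom

theorem act_id (X : C) : act X (𝟙 _) = 𝟙 X := by simp [act]

theorem act_comp (X : C) (a b : 𝟙_ C ⟶ 𝟙_ C) : act X (a ≫ b) = act X a ≫ act X b := by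
  simp [act]

theorem act_naturality {X Y : C} (f : X ⟶ Y) (a : 𝟙_ C ⟶ 𝟙_ C) :
    act X a ≫ f = f ≫ act Y a := by
  have h : f = (λ_ X).inv ≫ (𝟙_ C) ◁ f ≫ (λ_ Y).hom := by simp
  conv_lhs => rw [h]
  conv_rhs => rw [h]
  simp only [act, Category.assoc, Iso.hom_inv_id_assoc]
  rw [whisker_exchange_assoc]

theorem act_unit (a : 𝟙_ C ⟶ 𝟙_ C) : act (𝟙_ C) a = a := by
  rw [act, unitors_equal, rightUnitor_naturality, unitors_inv_equal, Iso.inv_hom_id_assoc]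

theorem act_bijective [CatGroup C] (X : C) : Function.Bijective (act X) := by
  have h := whiskerRight_bijective (𝟙_ C) (𝟙_ C) X
  have h2 : act X = (fun k : 𝟙_ C ⊗ X ⟶ 𝟙_ C ⊗ X => (λ_ X).inv ≫ k ≫ (λ_ X).hom) ∘
      (fun f : 𝟙_ C ⟶ 𝟙_ C => f ▷ X) := rfl
  rw [h2]
  refine Function.Bijective.comp ?_ h
  constructor
  · intro a b hab
    simpa using hab
  · intro k
    exact ⟨(λ_ X).hom ≫ k ≫ (λ_ X).inv, by simp⟩

theorem unit_comm (a b : 𝟙_ C ⟶ 𝟙_ C) : a ≫ b = b ≫ a := by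
  have := act_naturality b a
  rwa [act_unit] at this

theorem act_whiskerRight (X Y : C) (a : 𝟙_ C ⟶ 𝟙_ C) : act X a ▷ Y = act (X ⊗ Y) a := by
  simp [act]

theorem whiskerLeft_act [BraidedCategory C] (X Y : C) (a : 𝟙_ C ⟶ 𝟙_ C) :
    X ◁ act Y a = act (X ⊗ Y) a := by
  rw [← cancel_mono (β_ X Y).hom, BraidedCategory.braiding_naturality_right, act_whiskerRight,
    act_naturality]

end Generic

end CatGroup


/-- A symmetric categorical group structure on `A`, to be written additively: sum `⊕`, zero object,
constraints `a⁺, c⁺, g, d`. -/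
class SumStructure (A : Type u) [Category.{v} A] where
  monoidal : MonoidalCategory A
  symmetric : @SymmetricCategory A _ monoidal
  group : @CatGroup A _ monoidal

section SumOps

variable {A : Type u} [Category.{v} A] [SumStructure A]

/-- The braiding `c⁺` underlying the symmetric structure of the sum. -/
abbrev SumStructure.braided (A : Type u) [Category.{v} A] [S : SumStructure A] :
    @BraidedCategory A _ S.monoidal :=
  @SymmetricCategory.toBraidedCategory A _ S.monoidal S.symmetric

/-- The sum of two objects. -/
def sum (X Y : A) : A := @tensorObj A _ (SumStructure.monoidal (A := A)).toMonoidalCategoryStruct X Y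

/-- The sum of two morphisms. -/
def sumHom {X Y X' Y' : A} (f : X ⟶ Y) (g : X' ⟶ Y') : sum X X' ⟶ sum Y Y' :=
  @tensorHom A _ (SumStructure.monoidal (A := A)).toMonoidalCategoryStruct _ _ _ _ f g

infixr:65 " ⊕ₐ " => sum
infixr:65 " ⊕ₕ " => sumHom

/-- The zero object. -/
def zeroObj (A : Type u) [Category.{v} A] [SumStructure A] : A :=
  @tensorUnit A _ (SumStructure.monoidal (A := A)).toMonoidalCategoryStruct

/-- The associativity constraint of the sum. -/
def sumAssoc (X Y Z : A) : (X ⊕ₐ Y) ⊕ₐ Z ≅ X ⊕ₐ (Y ⊕ₐ Z) :=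
  @associator A _ (SumStructure.monoidal (A := A)).toMonoidalCategoryStruct X Y Z

/-- The commutativity constraint of the sum. -/
def sumComm (X Y : A) : X ⊕ₐ Y ≅ Y ⊕ₐ X :=
  @BraidedCategory.braiding A _ SumStructure.monoidal (SumStructure.braided A) X Y

/-- The left unit constraint `g` of the sum. -/
def zeroSum (X : A) : zeroObj A ⊕ₐ X ≅ X :=
  @leftUnitor A _ (SumStructure.monoidal (A := A)).toMonoidalCategoryStruct X

/-- The right unit constraint `d` of the sum. -/
def sumZero (X : A) : X ⊕ₐ zeroObj A ≅ X :=
  @rightUnitor A _ (SumStructure.monoidal (A := A)).toMonoidalCategoryStruct X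

/-- The canonical exchange `(U ⊕ V) ⊕ (Z ⊕ T) ⟶ (U ⊕ Z) ⊕ (V ⊕ T)` built from the associativity and
commutativity constraints of the sum. -/
def sumExchange (U V Z T : A) : (U ⊕ₐ V) ⊕ₐ (Z ⊕ₐ T) ⟶ (U ⊕ₐ Z) ⊕ₐ (V ⊕ₐ T) :=
  @tensorμ A _ SumStructure.monoidal (SumStructure.braided A) U V Z T

theorem isIso (A : Type u) [Category.{v} A] [S : SumStructure A] {X Y : A} (f : X ⟶ Y) : IsIso f :=
  @CatGroup.isIso A _ S.monoidal S.group X Y f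

@[simp]
theorem sumHom_id (X Y : A) : 𝟙 X ⊕ₕ 𝟙 Y = 𝟙 (X ⊕ₐ Y) :=
  @id_tensorHom_id A _ SumStructure.monoidal X Y

theorem sumHom_comp {X Y Z X' Y' Z' : A} (f : X ⟶ Y) (g : Y ⟶ Z) (f' : X' ⟶ Y') (g' : Y' ⟶ Z') :
    (f ≫ g) ⊕ₕ (f' ≫ g') = (f ⊕ₕ f') ≫ (g ⊕ₕ g') :=
  (@tensorHom_comp_tensorHom A _ SumStructure.monoidal _ _ _ _ _ _ f f' g g').symm

/-- The sum of two isomorphisms. -/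
def sumIso {X Y X' Y' : A} (e : X ≅ Y) (e' : X' ≅ Y') : X ⊕ₐ X' ≅ Y ⊕ₐ Y' where
  hom := e.hom ⊕ₕ e'.hom
  inv := e.inv ⊕ₕ e'.inv
  hom_inv_id := by rw [← sumHom_comp]; simp
  inv_hom_id := by rw [← sumHom_comp]; simp

theorem sumAssoc_naturality {X Y Z X' Y' Z' : A} (f : X ⟶ X') (g : Y ⟶ Y') (h : Z ⟶ Z') :
    ((f ⊕ₕ g) ⊕ₕ h) ≫ (sumAssoc X' Y' Z').hom = (sumAssoc X Y Z).hom ≫ (f ⊕ₕ (g ⊕ₕ h)) :=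
  @associator_naturality A _ SumStructure.monoidal _ _ _ _ _ _ f g h

theorem sumComm_naturality {X Y X' Y' : A} (f : X ⟶ X') (g : Y ⟶ Y') :
    (f ⊕ₕ g) ≫ (sumComm X' Y').hom = (sumComm X Y).hom ≫ (g ⊕ₕ f) :=
  @BraidedCategory.braiding_naturality A _ SumStructure.monoidal (SumStructure.braided A) _ _ _ _ f g

theorem zeroSum_naturality {X Y : A} (f : X ⟶ Y) :
    (𝟙 (zeroObj A) ⊕ₕ f) ≫ (zeroSum Y).hom = (zeroSum X).hom ≫ f := by
  have := @leftUnitor_naturality A _ SumStructure.monoidal _ _ f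
  rw [← @id_tensorHom A _ SumStructure.monoidal] at this
  exact this

theorem sumZero_naturality {X Y : A} (f : X ⟶ Y) :
    (f ⊕ₕ 𝟙 (zeroObj A)) ≫ (sumZero Y).hom = (sumZero X).hom ≫ f := by
  have := @rightUnitor_naturality A _ SumStructure.monoidal _ _ f
  rw [← @tensorHom_id A _ SumStructure.monoidal] at this
  exact this

theorem sumExchange_naturality {U V Z T U' V' Z' T' : A} (f : U ⟶ U') (g : V ⟶ V') (h : Z ⟶ Z')
    (k : T ⟶ T') : ((f ⊕ₕ g) ⊕ₕ (h ⊕ₕ k)) ≫ sumExchange U' V' Z' T' =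
      sumExchange U V Z T ≫ ((f ⊕ₕ h) ⊕ₕ (g ⊕ₕ k)) :=
  @tensorμ_natural A _ SumStructure.monoidal (SumStructure.braided A) _ _ _ _ _ _ _ _ f g h k

theorem exists_neg (X : A) : ∃ Y : A, Nonempty (Y ⊕ₐ X ≅ zeroObj A) := by
  obtain ⟨Y, -, h⟩ := @CatGroup.exists_inverse A _ SumStructure.monoidal SumStructure.group X
  exact ⟨Y, h⟩

theorem sumHom_id_bijective (X Y Z : A) :
    Function.Bijective (fun f : X ⟶ Y => f ⊕ₕ 𝟙 Z) := by
  have := @CatGroup.whiskerRight_bijective A _ SumStructure.monoidal SumStructure.group X Y Z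
  have h : (fun f : X ⟶ Y => f ⊕ₕ 𝟙 Z) = (fun f : X ⟶ Y =>
    @whiskerRight A _ (SumStructure.monoidal (A := A)).toMonoidalCategoryStruct _ _ f Z) := by
    funext f
    exact @tensorHom_id A _ SumStructure.monoidal _ _ f Z
  rw [h]
  exact this

end SumOps

/-- An Ann-category: a symmetric categorical group for `⊕` and a monoidal category for `⊗`
(the instance arguments), with natural distributivity isomorphisms `𝔏`, `ℜ`. -/
class AnnCategory (A : Type u) [Category.{v} A] [MonoidalCategory A] [SumStructure A] where
  distribL : ∀ X Y Z : A, X ⊗ (Y ⊕ₐ Z) ≅ (X ⊗ Y) ⊕ₐ (X ⊗ Z)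
  distribR : ∀ X Y Z : A, (X ⊕ₐ Y) ⊗ Z ≅ (X ⊗ Z) ⊕ₐ (Y ⊗ Z)
  distribL_naturality : ∀ {X Y Z X' Y' Z' : A} (f : X ⟶ X') (g : Y ⟶ Y') (h : Z ⟶ Z'),
    (f ⊗ₘ (g ⊕ₕ h)) ≫ (distribL X' Y' Z').hom =
      (distribL X Y Z).hom ≫ ((f ⊗ₘ g) ⊕ₕ (f ⊗ₘ h))
  distribR_naturality : ∀ {X Y Z X' Y' Z' : A} (f : X ⟶ X') (g : Y ⟶ Y') (h : Z ⟶ Z'),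
    ((f ⊕ₕ g) ⊗ₘ h) ≫ (distribR X' Y' Z').hom =
      (distribR X Y Z).hom ≫ ((f ⊗ₘ h) ⊕ₕ (g ⊗ₘ h))
  /-- `A ⊗ -` is compatible with `a⁺`. -/
  distribL_assoc : ∀ A' X Y Z : A,
    (distribL A' (X ⊕ₐ Y) Z).hom ≫ ((distribL A' X Y).hom ⊕ₕ 𝟙 (A' ⊗ Z)) ≫
        (sumAssoc (A' ⊗ X) (A' ⊗ Y) (A' ⊗ Z)).hom =
      A' ◁ (sumAssoc X Y Z).hom ≫ (distribL A' X (Y ⊕ₐ Z)).hom ≫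
        (𝟙 (A' ⊗ X) ⊕ₕ (distribL A' Y Z).hom)
  /-- `A ⊗ -` is compatible with `c⁺`. -/
  distribL_comm : ∀ A' X Y : A,
    (distribL A' X Y).hom ≫ (sumComm (A' ⊗ X) (A' ⊗ Y)).hom =
      A' ◁ (sumComm X Y).hom ≫ (distribL A' Y X).hom
  /-- `- ⊗ A` is compatible with `a⁺`. -/
  distribR_assoc : ∀ A' X Y Z : A,
    (distribR (X ⊕ₐ Y) Z A').hom ≫ ((distribR X Y A').hom ⊕ₕ 𝟙 (Z ⊗ A')) ≫
        (sumAssoc (X ⊗ A') (Y ⊗ A') (Z ⊗ A')).hom =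
      (sumAssoc X Y Z).hom ▷ A' ≫ (distribR X (Y ⊕ₐ Z) A').hom ≫
        (𝟙 (X ⊗ A') ⊕ₕ (distribR Y Z A').hom)
  /-- `- ⊗ A` is compatible with `c⁺`. -/
  distribR_comm : ∀ A' X Y : A,
    (distribR X Y A').hom ≫ (sumComm (X ⊗ A') (Y ⊗ A')).hom =
      (sumComm X Y).hom ▷ A' ≫ (distribR Y X A').hom
  distribL_tensor : ∀ A' B X Y : A,
    (distribL (A' ⊗ B) X Y).hom ≫ ((α_ A' B X).hom ⊕ₕ (α_ A' B Y).hom) =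
      (α_ A' B (X ⊕ₐ Y)).hom ≫ A' ◁ (distribL B X Y).hom ≫ (distribL A' (B ⊗ X) (B ⊗ Y)).hom
  distribR_tensor : ∀ X Y B A' : A,
    (distribR X Y B).hom ▷ A' ≫ (distribR (X ⊗ B) (Y ⊗ B) A').hom ≫
        ((α_ X B A').hom ⊕ₕ (α_ Y B A').hom) =
      (α_ (X ⊕ₐ Y) B A').hom ≫ (distribR X Y (B ⊗ A')).hom
  distribL_distribR_assoc : ∀ A' X Y B : A,
    (distribL A' X Y).hom ▷ B ≫ (distribR (A' ⊗ X) (A' ⊗ Y) B).hom ≫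
        ((α_ A' X B).hom ⊕ₕ (α_ A' Y B).hom) =
      (α_ A' (X ⊕ₐ Y) B).hom ≫ A' ◁ (distribR X Y B).hom ≫ (distribL A' (X ⊗ B) (Y ⊗ B)).hom
  distribL_distribR_exchange : ∀ A' B X Y : A,
    (distribL (A' ⊕ₐ B) X Y).hom ≫ ((distribR A' B X).hom ⊕ₕ (distribR A' B Y).hom) ≫
        sumExchange (A' ⊗ X) (B ⊗ X) (A' ⊗ Y) (B ⊗ Y) =
      (distribR A' B (X ⊕ₐ Y)).hom ≫ ((distribL A' X Y).hom ⊕ₕ (distribL B X Y).hom)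
  distribL_one : ∀ X Y : A,
    (distribL (𝟙_ A) X Y).hom ≫ ((λ_ X).hom ⊕ₕ (λ_ Y).hom) = (λ_ (X ⊕ₐ Y)).hom
  distribR_one : ∀ X Y : A,
    (distribR X Y (𝟙_ A)).hom ≫ ((ρ_ X).hom ⊕ₕ (ρ_ Y).hom) = (ρ_ (X ⊕ₐ Y)).hom


/-- A braided Ann-category: an Ann-category with a braiding for `⊗` (the instance argument)
compatible with the distributivity constraints. -/
class BraidedAnnCategory (A : Type u) [Category.{v} A] [MonoidalCategory A] [BraidedCategory A]
    [SumStructure A] extends AnnCategory A where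
  braiding_distrib : ∀ X Y Z : A,
    (distribL X Y Z).hom ≫ ((β_ X Y).hom ⊕ₕ (β_ X Z).hom) =
      (β_ X (Y ⊕ₐ Z)).hom ≫ (distribR Y Z X).hom
  braiding_zero : (β_ (zeroObj A) (zeroObj A)).hom = 𝟙 _

section Pi

variable {A : Type u} [Category.{v} A]

/-- `π₀`: the set of isomorphism classes of objects. -/
def Pi0 (A : Type u) [Category.{v} A] : Type u := Quotient (isIsomorphicSetoid A)

/-- The class of an object. -/
def Pi0.mk (X : A) : Pi0 A := Quotient.mk (isIsomorphicSetoid A) X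

theorem Pi0.ind {p : Pi0 A → Prop} (h : ∀ X : A, p (Pi0.mk X)) (s : Pi0 A) : p s :=
  Quotient.ind (s := isIsomorphicSetoid A) h s

theorem Pi0.sound {X Y : A} (e : X ≅ Y) : Pi0.mk X = Pi0.mk Y :=
  Quotient.sound (s := isIsomorphicSetoid A) ⟨e⟩

theorem Pi0.exact {X Y : A} (h : Pi0.mk X = Pi0.mk Y) : Nonempty (X ≅ Y) :=
  Quotient.exact (s := isIsomorphicSetoid A) h

section Sum

variable [SumStructure A]

instance : Zero (Pi0 A) := ⟨Pi0.mk (zeroObj A)⟩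

instance : Add (Pi0 A) :=
  ⟨Quotient.map₂ (sa := isIsomorphicSetoid A) (sb := isIsomorphicSetoid A)
    (sc := isIsomorphicSetoid A) (fun X Y => X ⊕ₐ Y)
    (fun _ _ ⟨e⟩ _ _ ⟨e'⟩ => ⟨sumIso e e'⟩)⟩

theorem Pi0.mk_add (X Y : A) : Pi0.mk X + Pi0.mk Y = Pi0.mk (X ⊕ₐ Y) := rfl

theorem Pi0.mk_zero : Pi0.mk (zeroObj A) = 0 := rfl

theorem Pi0.exists_neg (s : Pi0 A) : ∃ t : Pi0 A, t + s = 0 := by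
  induction s using Pi0.ind with
  | h X =>
    obtain ⟨Y, ⟨e⟩⟩ := BrAnn.exists_neg X
    exact ⟨Pi0.mk Y, Pi0.sound e⟩

noncomputable instance : Neg (Pi0 A) := ⟨fun s => (Pi0.exists_neg s).choose⟩

noncomputable instance : AddCommGroup (Pi0 A) where
  add_assoc a b c := by
    induction a using Pi0.ind; induction b using Pi0.ind; induction c using Pi0.ind
    exact Pi0.sound (sumAssoc _ _ _)
  zero_add a := by
    induction a using Pi0.ind
    exact Pi0.sound (zeroSum _)
  add_zero a := by
    induction a using Pi0.ind
    exact Pi0.sound (sumZero _)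
  add_comm a b := by
    induction a using Pi0.ind; induction b using Pi0.ind
    exact Pi0.sound (sumComm _ _)
  neg_add_cancel a := (Pi0.exists_neg a).choose_spec
  nsmul := nsmulRec
  zsmul := zsmulRec

/-- `π₁`: the group of automorphisms of the zero object, written additively. -/
def Pi1 (A : Type u) [Category.{v} A] [SumStructure A] : Type v := Additive (Aut (zeroObj A))

/-- The automorphism of the zero object underlying an element of `π₁`. -/
def Pi1.hom (a : Pi1 A) : zeroObj A ⟶ zeroObj A := (Additive.toMul a : Aut (zeroObj A)).hom

/-- Every endomorphism of the zero object is an automorphism. -/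
noncomputable def Pi1.mk (f : zeroObj A ⟶ zeroObj A) : Pi1 A :=
  Additive.ofMul (@asIso _ _ _ _ f (isIso A f))

@[simp]
theorem Pi1.hom_mk (f : zeroObj A ⟶ zeroObj A) : (Pi1.mk f).hom = f := rfl

@[ext]
theorem Pi1.ext {a b : Pi1 A} (h : a.hom = b.hom) : a = b :=
  Iso.ext (show (Additive.toMul a : Aut (zeroObj A)).hom = (Additive.toMul b : Aut (zeroObj A)).hom
    from h)

noncomputable instance : AddCommGroup (Pi1 A) :=
  { (inferInstance : AddGroup (Additive (Aut (zeroObj A)))) with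
    add_comm := fun a b => Pi1.ext
      (@CatGroup.unit_comm A _ SumStructure.monoidal (Pi1.hom b) (Pi1.hom a)) }

theorem Pi1.hom_add (a b : Pi1 A) : (a + b).hom = a.hom ≫ b.hom :=
  @CatGroup.unit_comm A _ SumStructure.monoidal (Pi1.hom b) (Pi1.hom a)

theorem Pi1.hom_zero : (0 : Pi1 A).hom = 𝟙 (zeroObj A) := rfl

theorem sum_act (X : A) (f : zeroObj A ⟶ zeroObj A) :
    (zeroSum X).inv ≫ (f ⊕ₕ 𝟙 X) ≫ (zeroSum X).hom =
      @CatGroup.act A _ SumStructure.monoidal X f := by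
  have h : f ⊕ₕ 𝟙 X =
      @whiskerRight A _ (SumStructure.monoidal (A := A)).toMonoidalCategoryStruct _ _ f X :=
    @tensorHom_id A _ SumStructure.monoidal _ _ f X
  rw [h]
  rfl

theorem gammaFun_bijective (X : A) : Function.Bijective (fun a : Pi1 A =>
    (zeroSum X).inv ≫ (a.hom ⊕ₕ 𝟙 X) ≫ (zeroSum X).hom) := by
  have h1 := @CatGroup.act_bijective A _ SumStructure.monoidal SumStructure.group X
  have h2 : Function.Bijective (Pi1.hom : Pi1 A → (zeroObj A ⟶ zeroObj A)) :=
    ⟨fun a b h => Pi1.ext h, fun f => ⟨Pi1.mk f, rfl⟩⟩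
  have h3 : (fun a : Pi1 A => (zeroSum X).inv ≫ (a.hom ⊕ₕ 𝟙 X) ≫ (zeroSum X).hom) =
      @CatGroup.act A _ SumStructure.monoidal X ∘ Pi1.hom := by
    funext a
    exact sum_act X a.hom
  rw [h3]
  exact h1.comp h2

/-- The bijection `γ_X : π₁ → Aut X`, determined by `g_X ∘ (u ⊕ id_X) = γ_X(u) ∘ g_X` (every
endomorphism of `X` is an automorphism). -/
noncomputable def gamma (X : A) : Pi1 A ≃ (X ⟶ X) := Equiv.ofBijective _ (gammaFun_bijective X)

theorem gamma_apply (X : A) (a : Pi1 A) :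
    gamma X a = (zeroSum X).inv ≫ (a.hom ⊕ₕ 𝟙 X) ≫ (zeroSum X).hom := rfl

theorem gamma_eq_act (X : A) (a : Pi1 A) :
    gamma X a = @CatGroup.act A _ SumStructure.monoidal X a.hom := by
  exact sum_act X a.hom

theorem gamma_add (X : A) (a b : Pi1 A) : gamma X (a + b) = gamma X a ≫ gamma X b := by
  simp only [gamma_eq_act, Pi1.hom_add]
  exact @CatGroup.act_comp A _ SumStructure.monoidal X _ _

theorem gamma_zero (X : A) : gamma X (0 : Pi1 A) = 𝟙 X := by
  rw [gamma_eq_act, Pi1.hom_zero]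
  exact @CatGroup.act_id A _ SumStructure.monoidal X

theorem gamma_naturality {X Y : A} (f : X ⟶ Y) (a : Pi1 A) :
    gamma X a ≫ f = f ≫ gamma Y a := by
  rw [gamma_eq_act, gamma_eq_act]
  exact @CatGroup.act_naturality A _ SumStructure.monoidal _ _ f _

theorem gamma_zeroObj (a : Pi1 A) : gamma (zeroObj A) a = a.hom := by
  rw [gamma_eq_act]
  exact @CatGroup.act_unit A _ SumStructure.monoidal _

theorem gamma_sumHom_id (X Y : A) (a : Pi1 A) :
    gamma X a ⊕ₕ 𝟙 Y = gamma (X ⊕ₐ Y) a := by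
  rw [gamma_eq_act, gamma_eq_act]
  refine Eq.trans ?_ (@CatGroup.act_whiskerRight A _ SumStructure.monoidal X Y a.hom)
  exact @tensorHom_id A _ SumStructure.monoidal _ _ _ _

theorem id_sumHom_gamma (X Y : A) (a : Pi1 A) :
    𝟙 X ⊕ₕ gamma Y a = gamma (X ⊕ₐ Y) a := by
  rw [gamma_eq_act, gamma_eq_act]
  refine Eq.trans ?_ (@CatGroup.whiskerLeft_act A _ SumStructure.monoidal
    (SumStructure.braided A) X Y a.hom)
  exact @id_tensorHom A _ SumStructure.monoidal _ _ _ _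

theorem gamma_sumHom_gamma (X Y : A) (a b : Pi1 A) :
    gamma X a ⊕ₕ gamma Y b = gamma (X ⊕ₐ Y) (a + b) := by
  rw [gamma_add, ← gamma_sumHom_id, ← id_sumHom_gamma, ← sumHom_comp]
  simp

theorem eq_gamma_of_conj {X Y : A} (e : X ⟶ Y) {f : X ⟶ X} {a : Pi1 A}
    (h : f ≫ e = e ≫ gamma Y a) : f = gamma X a := by
  have := isIso A e
  rw [← cancel_mono e, h, gamma_naturality]

end Sum

section Ann

variable [MonoidalCategory A] [SumStructure A] [AnnCategory A]

open AnnCategory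

theorem exists_lHat (X : A) : ∃ e : X ⊗ zeroObj A ⟶ zeroObj A,
    (distribL X (zeroObj A) (zeroObj A)).hom ≫ (e ⊕ₕ 𝟙 (X ⊗ zeroObj A)) ≫
      (zeroSum (X ⊗ zeroObj A)).hom = X ◁ (zeroSum (zeroObj A)).hom := by
  obtain ⟨e, he⟩ := (sumHom_id_bijective (X ⊗ zeroObj A) (zeroObj A) (X ⊗ zeroObj A)).2
    ((distribL X (zeroObj A) (zeroObj A)).inv ≫ X ◁ (zeroSum (zeroObj A)).hom ≫
      (zeroSum (X ⊗ zeroObj A)).inv)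
  refine ⟨e, ?_⟩
  dsimp only at he
  rw [he]
  simp

/-- The isomorphism `X ⊗ 0 ⟶ 0` induced by the `⊕`-functor `X ⊗ -`: the unique morphism through
which this functor is compatible with the unit constraint `g` (it is determined by this
compatibility at the object `0`). -/
noncomputable def lHat (X : A) : X ⊗ zeroObj A ⟶ zeroObj A := (exists_lHat X).choose

theorem lHat_spec (X : A) :
    (distribL X (zeroObj A) (zeroObj A)).hom ≫ (lHat X ⊕ₕ 𝟙 (X ⊗ zeroObj A)) ≫
      (zeroSum (X ⊗ zeroObj A)).hom = X ◁ (zeroSum (zeroObj A)).hom := (exists_lHat X).choose_spec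

theorem lHat_unique (X : A) (e : X ⊗ zeroObj A ⟶ zeroObj A)
    (h : (distribL X (zeroObj A) (zeroObj A)).hom ≫ (e ⊕ₕ 𝟙 (X ⊗ zeroObj A)) ≫
      (zeroSum (X ⊗ zeroObj A)).hom = X ◁ (zeroSum (zeroObj A)).hom) : e = lHat X := by
  rw [← lHat_spec, cancel_epi, cancel_mono] at h
  exact (sumHom_id_bijective _ _ _).1 h

theorem exists_rHat (X : A) : ∃ e : zeroObj A ⊗ X ⟶ zeroObj A,
    (distribR (zeroObj A) (zeroObj A) X).hom ≫ (e ⊕ₕ 𝟙 (zeroObj A ⊗ X)) ≫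
      (zeroSum (zeroObj A ⊗ X)).hom = (zeroSum (zeroObj A)).hom ▷ X := by
  obtain ⟨e, he⟩ := (sumHom_id_bijective (zeroObj A ⊗ X) (zeroObj A) (zeroObj A ⊗ X)).2
    ((distribR (zeroObj A) (zeroObj A) X).inv ≫ (zeroSum (zeroObj A)).hom ▷ X ≫
      (zeroSum (zeroObj A ⊗ X)).inv)
  refine ⟨e, ?_⟩
  dsimp only at he
  rw [he]
  simp

/-- The isomorphism `0 ⊗ X ⟶ 0` induced by the `⊕`-functor `- ⊗ X`. -/
noncomputable def rHat (X : A) : zeroObj A ⊗ X ⟶ zeroObj A := (exists_rHat X).choose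

theorem rHat_spec (X : A) :
    (distribR (zeroObj A) (zeroObj A) X).hom ≫ (rHat X ⊕ₕ 𝟙 (zeroObj A ⊗ X)) ≫
      (zeroSum (zeroObj A ⊗ X)).hom = (zeroSum (zeroObj A)).hom ▷ X := (exists_rHat X).choose_spec

/-- The function `λ_X : π₁ → π₁`, with `λ_X(u) ∘ L̂ = L̂ ∘ (id ⊗ u)`. -/
noncomputable def lam (X : A) (a : Pi1 A) : Pi1 A :=
  letI := isIso A (lHat X)
  Pi1.mk (inv (lHat X) ≫ X ◁ a.hom ≫ lHat X)

theorem whiskerLeft_hom (X : A) (a : Pi1 A) : X ◁ a.hom = gamma (X ⊗ zeroObj A) (lam X a) := by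
  have := isIso A (lHat X)
  apply eq_gamma_of_conj (lHat X)
  rw [gamma_zeroObj, lam]
  simp

theorem lam_eq_of (X : A) {a b : Pi1 A} (h : X ◁ a.hom = gamma (X ⊗ zeroObj A) b) :
    lam X a = b := by
  rw [whiskerLeft_hom] at h
  exact (gamma _).injective h

theorem whiskerLeft_gamma (X Y : A) (a : Pi1 A) :
    X ◁ gamma Y a = gamma (X ⊗ Y) (lam X a) := by
  apply eq_gamma_of_conj (X ◁ (zeroSum Y).inv ≫ (distribL X (zeroObj A) Y).hom)
  have h := distribL_naturality (𝟙 X) a.hom (𝟙 Y)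
  rw [Category.assoc, ← gamma_sumHom_id, ← whiskerLeft_hom, ← id_tensorHom, ← id_tensorHom,
    ← id_tensorHom]
  rw [id_tensorHom_id] at h
  rw [← h, tensorHom_comp_tensorHom_assoc, tensorHom_comp_tensorHom_assoc, gamma_apply]
  simp

theorem lam_add_right (X : A) (a b : Pi1 A) : lam X (a + b) = lam X a + lam X b := by
  apply lam_eq_of
  rw [Pi1.hom_add, MonoidalCategory.whiskerLeft_comp, whiskerLeft_hom, whiskerLeft_hom, gamma_add]

theorem lam_iso {X Y : A} (e : X ≅ Y) (a : Pi1 A) : lam X a = lam Y a := by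
  apply lam_eq_of
  apply eq_gamma_of_conj (e.hom ▷ zeroObj A)
  rw [whisker_exchange, whiskerLeft_hom]

theorem lam_tensor (X Y : A) (a : Pi1 A) : lam (X ⊗ Y) a = lam X (lam Y a) := by
  apply lam_eq_of
  apply eq_gamma_of_conj (α_ X Y (zeroObj A)).hom
  rw [← whiskerLeft_gamma, ← whiskerLeft_hom]
  simp

theorem lam_one (a : Pi1 A) : lam (𝟙_ A) a = a := by
  apply lam_eq_of
  apply eq_gamma_of_conj (λ_ (zeroObj A)).hom
  rw [gamma_zeroObj, leftUnitor_naturality]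

theorem lam_sum (X Y : A) (a : Pi1 A) : lam (X ⊕ₐ Y) a = lam X a + lam Y a := by
  apply lam_eq_of
  apply eq_gamma_of_conj (distribR X Y (zeroObj A)).hom
  have h := distribR_naturality (𝟙 X) (𝟙 Y) a.hom
  rw [sumHom_id, id_tensorHom, id_tensorHom, id_tensorHom] at h
  rw [h, whiskerLeft_hom, whiskerLeft_hom, gamma_sumHom_gamma]

theorem lam_zeroObj (a : Pi1 A) : lam (zeroObj A) a = 0 := by
  have h := lam_sum (zeroObj A) (zeroObj A) a
  rw [lam_iso (zeroSum (zeroObj A)) a] at h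
  simpa using h

noncomputable instance : SMul (Pi0 A) (Pi1 A) :=
  ⟨fun s a => Quotient.lift (s := isIsomorphicSetoid A) (fun X => lam X a)
    (fun _ _ ⟨e⟩ => lam_iso e a) s⟩

theorem Pi0.mk_smul (X : A) (a : Pi1 A) : Pi0.mk X • a = lam X a := rfl

end Ann

section Tensor

variable [MonoidalCategory A]

instance : One (Pi0 A) := ⟨Pi0.mk (𝟙_ A)⟩

instance : Mul (Pi0 A) :=
  ⟨Quotient.map₂ (sa := isIsomorphicSetoid A) (sb := isIsomorphicSetoid A)
    (sc := isIsomorphicSetoid A) (fun X Y => X ⊗ Y)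
    (fun _ _ ⟨e⟩ _ _ ⟨e'⟩ => ⟨e ⊗ᵢ e'⟩)⟩

theorem Pi0.mk_mul (X Y : A) : Pi0.mk X * Pi0.mk Y = Pi0.mk (X ⊗ Y) := rfl

theorem Pi0.mk_one : Pi0.mk (𝟙_ A) = 1 := rfl

theorem Pi0.mul_comm' [BraidedCategory A] (a b : Pi0 A) : a * b = b * a := by
  induction a using Pi0.ind; induction b using Pi0.ind
  exact Pi0.sound (β_ _ _)

theorem Pi0.left_distrib' [SumStructure A] [AnnCategory A] (a b c : Pi0 A) :
    a * (b + c) = a * b + a * c := by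
  induction a using Pi0.ind; induction b using Pi0.ind; induction c using Pi0.ind
  exact Pi0.sound (AnnCategory.distribL _ _ _)

theorem Pi0.right_distrib' [SumStructure A] [AnnCategory A] (a b c : Pi0 A) :
    (a + b) * c = a * c + b * c := by
  induction a using Pi0.ind; induction b using Pi0.ind; induction c using Pi0.ind
  exact Pi0.sound (AnnCategory.distribR _ _ _)

end Tensor

section Braided

variable [MonoidalCategory A] [BraidedCategory A] [SumStructure A] [BraidedAnnCategory A]

/-- The commutative ring structure on `π₀` induced by `⊕` and `⊗`. -/
noncomputable instance : CommRing (Pi0 A) :=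
  { (inferInstance : AddCommGroup (Pi0 A)) with
    mul_assoc := fun a b c => by
      induction a using Pi0.ind; induction b using Pi0.ind; induction c using Pi0.ind
      exact Pi0.sound (α_ _ _ _)
    one_mul := fun a => by
      induction a using Pi0.ind
      exact Pi0.sound (λ_ _)
    mul_one := fun a => by
      induction a using Pi0.ind
      exact Pi0.sound (ρ_ _)
    left_distrib := Pi0.left_distrib'
    right_distrib := Pi0.right_distrib'
    zero_mul := fun a => by
      have h := Pi0.right_distrib' 0 0 a
      simpa using h
    mul_zero := fun a => by
      have h := Pi0.left_distrib' a 0 0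
      simpa using h
    mul_comm := Pi0.mul_comm' }

/-- The `π₀`-module structure on `π₁`, with `[X] • u = λ_X(u)`. -/
noncomputable instance : Module (Pi0 A) (Pi1 A) where
  one_smul a := lam_one a
  mul_smul s t a := by
    induction s using Pi0.ind; induction t using Pi0.ind
    exact lam_tensor _ _ a
  smul_add s a b := by
    induction s using Pi0.ind
    exact lam_add_right _ a b
  smul_zero s := by
    induction s using Pi0.ind with
    | h X => have h := lam_add_right X 0 0; simpa [Pi0.mk_smul] using h
  add_smul s t a := by
    induction s using Pi0.ind; induction t using Pi0.ind
    exact lam_sum _ _ a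
  zero_smul a := lam_zeroObj a

theorem whiskerLeft_gamma' (X Y : A) (a : Pi1 A) :
    X ◁ gamma Y a = gamma (X ⊗ Y) (Pi0.mk X • a) := whiskerLeft_gamma X Y a

theorem gamma_whiskerRight (X Y : A) (a : Pi1 A) :
    gamma X a ▷ Y = gamma (X ⊗ Y) (Pi0.mk Y • a) := by
  apply eq_gamma_of_conj (β_ X Y).hom
  rw [BraidedCategory.braiding_naturality_left, whiskerLeft_gamma']

theorem gamma_tensorHom_gamma (X Y : A) (a b : Pi1 A) :
    gamma X a ⊗ₘ gamma Y b = gamma (X ⊗ Y) (Pi0.mk X • b + Pi0.mk Y • a) := by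
  rw [tensorHom_def', gamma_add, whiskerLeft_gamma', gamma_whiskerRight]

end Braided

end Pi

section Functors

variable {A : Type u₁} [Category.{v₁} A] {B : Type u₂} [Category.{v₂} B]
  {C : Type u₃} [Category.{v₃} C]

theorem sumHom_comp_assoc [SumStructure A] {X Y Z X' Y' Z' W : A} (f : X ⟶ Y) (g : Y ⟶ Z)
    (f' : X' ⟶ Y') (g' : Y' ⟶ Z') (k : Z ⊕ₐ Z' ⟶ W) :
    (f ⊕ₕ f') ≫ (g ⊕ₕ g') ≫ k = ((f ≫ g) ⊕ₕ (f' ≫ g')) ≫ k := by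
  rw [sumHom_comp, Category.assoc]

/-- A symmetric monoidal functor structure for the sums. (For functors between categorical groups
the unit isomorphism is determined by the rest of the structure.) -/
abbrev SumFunctor [SumStructure A] [SumStructure B] (F : A ⥤ B) :=
  @Functor.Braided A _ SumStructure.monoidal (SumStructure.braided A)
    B _ SumStructure.monoidal (SumStructure.braided B) F

section SumFunctor

variable [SumStructure A] [SumStructure B] {F : A ⥤ B} (h : SumFunctor F)

/-- The underlying lax braided structure for the sums. -/
abbrev sumLaxBraided : @Functor.LaxBraided A _ SumStructure.monoidal (SumStructure.braided A)
    B _ SumStructure.monoidal (SumStructure.braided B) F :=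
  @Functor.Braided.toLaxBraided A _ SumStructure.monoidal (SumStructure.braided A)
    B _ SumStructure.monoidal (SumStructure.braided B) F h

/-- The underlying lax monoidal structure for the sums. -/
abbrev sumLax : @Functor.LaxMonoidal A _ SumStructure.monoidal B _ SumStructure.monoidal F :=
  @Functor.LaxBraided.toLaxMonoidal A _ SumStructure.monoidal (SumStructure.braided A)
    B _ SumStructure.monoidal (SumStructure.braided B) F (sumLaxBraided h)

/-- The isomorphisms `F X ⊕ F Y ⟶ F (X ⊕ Y)` of a functor which is monoidal for the sums. -/
def sumMu (X Y : A) : F.obj X ⊕ₐ F.obj Y ⟶ F.obj (X ⊕ₐ Y) :=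
  @Functor.LaxMonoidal.μ A _ SumStructure.monoidal B _ SumStructure.monoidal F
    (sumLax h) X Y

/-- The isomorphism `0 ⟶ F 0` of a functor which is monoidal for the sums. -/
def sumEps : zeroObj B ⟶ F.obj (zeroObj A) :=
  @Functor.LaxMonoidal.ε A _ SumStructure.monoidal B _ SumStructure.monoidal F
    (sumLax h)

theorem sumMu_naturality {X Y X' Y' : A} (f : X ⟶ X') (g : Y ⟶ Y') :
    (F.map f ⊕ₕ F.map g) ≫ sumMu h X' Y' = sumMu h X Y ≫ F.map (f ⊕ₕ g) :=
  @Functor.LaxMonoidal.μ_natural A _ SumStructure.monoidal B _ SumStructure.monoidal F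
    (sumLax h) _ _ _ _ f g

theorem sumMu_associativity (X Y Z : A) :
    (sumMu h X Y ⊕ₕ 𝟙 (F.obj Z)) ≫ sumMu h (X ⊕ₐ Y) Z ≫ F.map (sumAssoc X Y Z).hom =
      (sumAssoc (F.obj X) (F.obj Y) (F.obj Z)).hom ≫ (𝟙 (F.obj X) ⊕ₕ sumMu h Y Z) ≫
        sumMu h X (Y ⊕ₐ Z) := by
  have := @Functor.LaxMonoidal.associativity A _ SumStructure.monoidal B _ SumStructure.monoidal F
    (sumLax h) X Y Z
  rw [← @tensorHom_id B _ SumStructure.monoidal, ← @id_tensorHom B _ SumStructure.monoidal] at this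
  exact this

theorem sumMu_commutativity (X Y : A) :
    sumMu h X Y ≫ F.map (sumComm X Y).hom =
      (sumComm (F.obj X) (F.obj Y)).hom ≫ sumMu h Y X :=
  @Functor.LaxBraided.braided A _ SumStructure.monoidal (SumStructure.braided A)
    B _ SumStructure.monoidal (SumStructure.braided B) F (sumLaxBraided h) X Y

theorem sumMu_exchange (U V Z T : A) :
    sumExchange (F.obj U) (F.obj V) (F.obj Z) (F.obj T) ≫
        (sumMu h U Z ⊕ₕ sumMu h V T) ≫ sumMu h (U ⊕ₐ Z) (V ⊕ₐ T) =
      (sumMu h U V ⊕ₕ sumMu h Z T) ≫ sumMu h (U ⊕ₐ V) (Z ⊕ₐ T) ≫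
        F.map (sumExchange U V Z T) :=
  @tensorμ_comp_μ_tensorHom_μ_comp_μ A _ SumStructure.monoidal (SumStructure.braided A)
    B _ SumStructure.monoidal (SumStructure.braided B) F (sumLaxBraided h) U V Z T

end SumFunctor

section Transport

open Functor.LaxMonoidal AnnCategory

theorem mu_assoc' [MonoidalCategory A] [MonoidalCategory B] {H : B ⥤ A} [H.Monoidal] (X Y Z : B) :
    (μ H X Y ⊗ₘ 𝟙 (H.obj Z)) ≫ μ H (X ⊗ Y) Z ≫ H.map (α_ X Y Z).hom =
      (α_ (H.obj X) (H.obj Y) (H.obj Z)).hom ≫ (𝟙 (H.obj X) ⊗ₘ μ H Y Z) ≫ μ H X (Y ⊗ Z) := by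
  simp

variable [MonoidalCategory A] [SumStructure A] [AnnCategory A] [MonoidalCategory B] [SumStructure B]

/-- Distributivity isomorphisms on `B` which are carried to those of `A` by a functor `H : B ⥤ A`
monoidal for both operations. -/
structure DistribTransport (H : B ⥤ A) [H.Monoidal] (h : SumFunctor H) where
  dL : ∀ X Y Z : B, X ⊗ (Y ⊕ₐ Z) ≅ (X ⊗ Y) ⊕ₐ (X ⊗ Z)
  dR : ∀ X Y Z : B, (X ⊕ₐ Y) ⊗ Z ≅ (X ⊗ Z) ⊕ₐ (Y ⊗ Z)
  hL : ∀ X Y Z : B, (𝟙 (H.obj X) ⊗ₘ sumMu h Y Z) ≫ μ H X (Y ⊕ₐ Z) ≫ H.map (dL X Y Z).hom =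
    (distribL (H.obj X) (H.obj Y) (H.obj Z)).hom ≫ (μ H X Y ⊕ₕ μ H X Z) ≫ sumMu h (X ⊗ Y) (X ⊗ Z)
  hR : ∀ X Y Z : B, (sumMu h X Y ⊗ₘ 𝟙 (H.obj Z)) ≫ μ H (X ⊕ₐ Y) Z ≫ H.map (dR X Y Z).hom =
    (distribR (H.obj X) (H.obj Y) (H.obj Z)).hom ≫ (μ H X Z ⊕ₕ μ H Y Z) ≫ sumMu h (X ⊗ Z) (Y ⊗ Z)

variable {H : B ⥤ A} [H.Faithful] [H.Monoidal] {h : SumFunctor H} (t : DistribTransport H h)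


section Laws

theorem tr_natL {X Y Z X' Y' Z' : B} (f : X ⟶ X') (g : Y ⟶ Y') (k : Z ⟶ Z') :
    (f ⊗ₘ (g ⊕ₕ k)) ≫ (t.dL X' Y' Z').hom =
      (t.dL X Y Z).hom ≫ ((f ⊗ₘ g) ⊕ₕ (f ⊗ₘ k)) := by
  have iA := @isIso A _ _
  apply H.map_injective
  rw [← cancel_epi ((𝟙 (H.obj X) ⊗ₘ sumMu h Y Z) ≫ μ H X (Y ⊕ₐ Z))]
  simp only [Functor.map_comp, Category.assoc]
  rw [reassoc_of% t.hL, ← sumMu_naturality, sumHom_comp_assoc, ← μ_natural, ← μ_natural,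
    ← μ_natural_assoc, tensorHom_comp_tensorHom_assoc, ← sumMu_naturality]
  rw [Category.id_comp, ← Category.comp_id (H.map f), ← tensorHom_comp_tensorHom_assoc,
    t.hL, reassoc_of% distribL_naturality, sumHom_comp_assoc]
  simp

theorem tr_natR {X Y Z X' Y' Z' : B} (f : X ⟶ X') (g : Y ⟶ Y') (k : Z ⟶ Z') :
    ((f ⊕ₕ g) ⊗ₘ k) ≫ (t.dR X' Y' Z').hom =
      (t.dR X Y Z).hom ≫ ((f ⊗ₘ k) ⊕ₕ (g ⊗ₘ k)) := by
  have iA := @isIso A _ _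
  apply H.map_injective
  rw [← cancel_epi ((sumMu h X Y ⊗ₘ 𝟙 (H.obj Z)) ≫ μ H (X ⊕ₐ Y) Z)]
  simp only [Functor.map_comp, Category.assoc]
  rw [reassoc_of% t.hR, ← sumMu_naturality, sumHom_comp_assoc, ← μ_natural, ← μ_natural,
    ← μ_natural_assoc, tensorHom_comp_tensorHom_assoc, ← sumMu_naturality]
  rw [Category.id_comp, ← Category.comp_id (H.map k), ← tensorHom_comp_tensorHom_assoc,
    t.hR, reassoc_of% distribR_naturality, sumHom_comp_assoc]
  simp

theorem tr_L_assoc (W X Y Z : B) :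
    (t.dL W (X ⊕ₐ Y) Z).hom ≫ ((t.dL W X Y).hom ⊕ₕ 𝟙 (W ⊗ Z)) ≫
        (sumAssoc (W ⊗ X) (W ⊗ Y) (W ⊗ Z)).hom =
      W ◁ (sumAssoc X Y Z).hom ≫ (t.dL W X (Y ⊕ₐ Z)).hom ≫
        (𝟙 (W ⊗ X) ⊕ₕ (t.dL W Y Z).hom) := by
  have iA := @isIso A _ _
  apply H.map_injective
  have e1 := distribL_naturality (𝟙 (H.obj W)) (sumMu h X Y) (𝟙 (H.obj Z))
  have e2 := distribL_naturality (𝟙 (H.obj W)) (𝟙 (H.obj X)) (sumMu h Y Z)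
  rw [id_tensorHom_id] at e1 e2
  rw [← cancel_epi ((𝟙 (H.obj W) ⊗ₘ (sumMu h X Y ⊕ₕ 𝟙 (H.obj Z))) ≫
    (𝟙 (H.obj W) ⊗ₘ sumMu h (X ⊕ₐ Y) Z) ≫ μ H W ((X ⊕ₐ Y) ⊕ₐ Z))]
  simp only [Functor.map_comp, Category.assoc, ← id_tensorHom W]
  have e3 : ((distribL (H.obj W) (H.obj X) (H.obj Y)).hom ≫ (μ H W X ⊕ₕ μ H W Y) ≫
      sumMu h (W ⊗ X) (W ⊗ Y)) ⊕ₕ μ H W Z =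
      ((distribL (H.obj W) (H.obj X) (H.obj Y)).hom ⊕ₕ 𝟙 _) ≫ ((μ H W X ⊕ₕ μ H W Y) ⊕ₕ μ H W Z) ≫
      (sumMu h (W ⊗ X) (W ⊗ Y) ⊕ₕ 𝟙 _) := by
    simp only [← sumHom_comp, Category.id_comp, Category.comp_id]
  have e4 : μ H W X ⊕ₕ ((distribL (H.obj W) (H.obj Y) (H.obj Z)).hom ≫ (μ H W Y ⊕ₕ μ H W Z) ≫
      sumMu h (W ⊗ Y) (W ⊗ Z)) =
      (𝟙 _ ⊕ₕ (distribL (H.obj W) (H.obj Y) (H.obj Z)).hom) ≫ (μ H W X ⊕ₕ (μ H W Y ⊕ₕ μ H W Z)) ≫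
      (𝟙 _ ⊕ₕ sumMu h (W ⊗ Y) (W ⊗ Z)) := by
    simp only [← sumHom_comp, Category.id_comp, Category.comp_id]
  calc _ = (distribL (H.obj W) (H.obj X ⊕ₐ H.obj Y) (H.obj Z)).hom ≫
        (((𝟙 _ ⊗ₘ sumMu h X Y) ≫ μ H W (X ⊕ₐ Y) ≫ H.map (t.dL W X Y).hom) ⊕ₕ μ H W Z) ≫
        sumMu h _ _ ≫ H.map (sumAssoc (W ⊗ X) (W ⊗ Y) (W ⊗ Z)).hom := by
        rw [reassoc_of% t.hL, reassoc_of% e1, ← reassoc_of% (sumMu_naturality h), H.map_id,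
          sumHom_comp_assoc, sumHom_comp_assoc]
        simp only [Category.assoc, Category.id_comp, Category.comp_id]
    _ = (𝟙 (H.obj W) ⊗ₘ (sumAssoc _ _ _).hom) ≫ (distribL _ _ _).hom ≫
        (μ H W X ⊕ₕ ((𝟙 _ ⊗ₘ sumMu h Y Z) ≫ μ H W (Y ⊕ₐ Z) ≫ H.map (t.dL W Y Z).hom)) ≫
        sumMu h _ _ := by
        rw [t.hL, t.hL, e3, e4]
        simp only [Category.assoc]
        rw [sumMu_associativity, reassoc_of% sumAssoc_naturality, reassoc_of% distribL_assoc,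
          id_tensorHom]
    _ = _ := by
        rw [← μ_natural_assoc, tensorHom_comp_tensorHom_assoc, tensorHom_comp_tensorHom_assoc]
        simp only [Category.assoc, CategoryTheory.Functor.map_id, Category.id_comp]
        rw [sumMu_associativity]
        have e5 : 𝟙 (H.obj W) ⊗ₘ ((sumAssoc (H.obj X) (H.obj Y) (H.obj Z)).hom ≫
            (𝟙 (H.obj X) ⊕ₕ sumMu h Y Z) ≫ sumMu h X (Y ⊕ₐ Z)) =
            (𝟙 _ ⊗ₘ (sumAssoc (H.obj X) (H.obj Y) (H.obj Z)).hom) ≫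
            (𝟙 _ ⊗ₘ (𝟙 (H.obj X) ⊕ₕ sumMu h Y Z)) ≫ (𝟙 _ ⊗ₘ sumMu h X (Y ⊕ₐ Z)) := by simp
        rw [e5]
        simp only [Category.assoc]
        rw [reassoc_of% t.hL, reassoc_of% e2, sumHom_comp_assoc, ← sumMu_naturality, H.map_id,
          sumHom_comp_assoc]
        simp only [Category.id_comp, Category.comp_id, Category.assoc]

theorem tr_R_assoc (W X Y Z : B) :
    (t.dR (X ⊕ₐ Y) Z W).hom ≫ ((t.dR X Y W).hom ⊕ₕ 𝟙 (Z ⊗ W)) ≫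
        (sumAssoc (X ⊗ W) (Y ⊗ W) (Z ⊗ W)).hom =
      (sumAssoc X Y Z).hom ▷ W ≫ (t.dR X (Y ⊕ₐ Z) W).hom ≫
        (𝟙 (X ⊗ W) ⊕ₕ (t.dR Y Z W).hom) := by
  have iA := @isIso A _ _
  apply H.map_injective
  have e1 := distribR_naturality (sumMu h X Y) (𝟙 (H.obj Z)) (𝟙 (H.obj W))
  have e2 := distribR_naturality (𝟙 (H.obj X)) (sumMu h Y Z) (𝟙 (H.obj W))
  rw [id_tensorHom_id] at e1 e2
  rw [← cancel_epi (((sumMu h X Y ⊕ₕ 𝟙 (H.obj Z)) ⊗ₘ 𝟙 (H.obj W)) ≫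
    (sumMu h (X ⊕ₐ Y) Z ⊗ₘ 𝟙 (H.obj W)) ≫ μ H ((X ⊕ₐ Y) ⊕ₐ Z) W)]
  simp only [Functor.map_comp, Category.assoc, ← tensorHom_id _ W]
  have e3 : ((distribR (H.obj X) (H.obj Y) (H.obj W)).hom ≫ (μ H X W ⊕ₕ μ H Y W) ≫
      sumMu h (X ⊗ W) (Y ⊗ W)) ⊕ₕ μ H Z W =
      ((distribR (H.obj X) (H.obj Y) (H.obj W)).hom ⊕ₕ 𝟙 _) ≫ ((μ H X W ⊕ₕ μ H Y W) ⊕ₕ μ H Z W) ≫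
      (sumMu h (X ⊗ W) (Y ⊗ W) ⊕ₕ 𝟙 _) := by
    simp only [← sumHom_comp, Category.id_comp, Category.comp_id]
  have e4 : μ H X W ⊕ₕ ((distribR (H.obj Y) (H.obj Z) (H.obj W)).hom ≫ (μ H Y W ⊕ₕ μ H Z W) ≫
      sumMu h (Y ⊗ W) (Z ⊗ W)) =
      (𝟙 _ ⊕ₕ (distribR (H.obj Y) (H.obj Z) (H.obj W)).hom) ≫ (μ H X W ⊕ₕ (μ H Y W ⊕ₕ μ H Z W)) ≫
      (𝟙 _ ⊕ₕ sumMu h (Y ⊗ W) (Z ⊗ W)) := by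
    simp only [← sumHom_comp, Category.id_comp, Category.comp_id]
  calc _ = (distribR (H.obj X ⊕ₐ H.obj Y) (H.obj Z) (H.obj W)).hom ≫
        (((sumMu h X Y ⊗ₘ 𝟙 _) ≫ μ H (X ⊕ₐ Y) W ≫ H.map (t.dR X Y W).hom) ⊕ₕ μ H Z W) ≫
        sumMu h _ _ ≫ H.map (sumAssoc (X ⊗ W) (Y ⊗ W) (Z ⊗ W)).hom := by
        rw [reassoc_of% t.hR, reassoc_of% e1, ← reassoc_of% (sumMu_naturality h), H.map_id,
          sumHom_comp_assoc, sumHom_comp_assoc]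
        simp only [Category.assoc, Category.id_comp, Category.comp_id]
    _ = ((sumAssoc _ _ _).hom ⊗ₘ 𝟙 (H.obj W)) ≫ (distribR _ _ _).hom ≫
        (μ H X W ⊕ₕ ((sumMu h Y Z ⊗ₘ 𝟙 _) ≫ μ H (Y ⊕ₐ Z) W ≫ H.map (t.dR Y Z W).hom)) ≫
        sumMu h _ _ := by
        rw [t.hR, t.hR, e3, e4]
        simp only [Category.assoc]
        rw [sumMu_associativity, reassoc_of% sumAssoc_naturality, reassoc_of% distribR_assoc,
          tensorHom_id]
    _ = _ := by
        rw [← μ_natural_assoc, tensorHom_comp_tensorHom_assoc, tensorHom_comp_tensorHom_assoc]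
        simp only [Category.assoc, CategoryTheory.Functor.map_id, Category.id_comp]
        rw [sumMu_associativity]
        have e5 : ((sumAssoc (H.obj X) (H.obj Y) (H.obj Z)).hom ≫
            (𝟙 (H.obj X) ⊕ₕ sumMu h Y Z) ≫ sumMu h X (Y ⊕ₐ Z)) ⊗ₘ 𝟙 (H.obj W) =
            ((sumAssoc (H.obj X) (H.obj Y) (H.obj Z)).hom ⊗ₘ 𝟙 _) ≫
            ((𝟙 (H.obj X) ⊕ₕ sumMu h Y Z) ⊗ₘ 𝟙 _) ≫ (sumMu h X (Y ⊕ₐ Z) ⊗ₘ 𝟙 _) := by simp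
        rw [e5]
        simp only [Category.assoc]
        rw [reassoc_of% t.hR, reassoc_of% e2, sumHom_comp_assoc, ← sumMu_naturality, H.map_id,
          sumHom_comp_assoc]
        simp only [Category.id_comp, Category.comp_id, Category.assoc]

theorem tr_L_comm (W X Y : B) :
    (t.dL W X Y).hom ≫ (sumComm (W ⊗ X) (W ⊗ Y)).hom =
      W ◁ (sumComm X Y).hom ≫ (t.dL W Y X).hom := by
  have iA := @isIso A _ _
  apply H.map_injective
  rw [← cancel_epi ((𝟙 (H.obj W) ⊗ₘ sumMu h X Y) ≫ μ H W (X ⊕ₐ Y))]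
  simp only [Functor.map_comp, Category.assoc, ← id_tensorHom W]
  rw [reassoc_of% t.hL, sumMu_commutativity, reassoc_of% sumComm_naturality,
    reassoc_of% distribL_comm, ← μ_natural_assoc, tensorHom_comp_tensorHom_assoc,
    sumMu_commutativity, ← tensorHom_comp_tensorHom_assoc, H.map_id, t.hL, id_tensorHom]

theorem tr_R_comm (W X Y : B) :
    (t.dR X Y W).hom ≫ (sumComm (X ⊗ W) (Y ⊗ W)).hom =
      (sumComm X Y).hom ▷ W ≫ (t.dR Y X W).hom := by
  have iA := @isIso A _ _
  apply H.map_injective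
  rw [← cancel_epi ((sumMu h X Y ⊗ₘ 𝟙 (H.obj W)) ≫ μ H (X ⊕ₐ Y) W)]
  simp only [Functor.map_comp, Category.assoc, ← tensorHom_id _ W]
  rw [reassoc_of% t.hR, sumMu_commutativity, reassoc_of% sumComm_naturality,
    reassoc_of% distribR_comm, ← μ_natural_assoc, tensorHom_comp_tensorHom_assoc,
    sumMu_commutativity, ← tensorHom_comp_tensorHom_assoc, H.map_id, t.hR, tensorHom_id]

theorem tr_L_tensor (V W X Y : B) :
    (t.dL (V ⊗ W) X Y).hom ≫ ((α_ V W X).hom ⊕ₕ (α_ V W Y).hom) =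
      (α_ V W (X ⊕ₐ Y)).hom ≫ V ◁ (t.dL W X Y).hom ≫ (t.dL V (W ⊗ X) (W ⊗ Y)).hom := by
  have iA := @isIso A _ _
  apply H.map_injective
  have e1 := distribL_naturality (μ H V W) (𝟙 (H.obj X)) (𝟙 (H.obj Y))
  have e2 := distribL_naturality (𝟙 (H.obj V)) (μ H W X) (μ H W Y)
  rw [sumHom_id] at e1
  rw [← cancel_epi ((μ H V W ⊗ₘ 𝟙 (H.obj X ⊕ₐ H.obj Y)) ≫ (𝟙 _ ⊗ₘ sumMu h X Y) ≫
    μ H (V ⊗ W) (X ⊕ₐ Y))]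
  simp only [Functor.map_comp, Category.assoc, ← id_tensorHom V]
  rw [reassoc_of% t.hL, reassoc_of% e1, ← sumMu_naturality, sumHom_comp_assoc, sumHom_comp_assoc,
    Category.assoc, Category.assoc, mu_assoc', mu_assoc', sumHom_comp, Category.assoc,
    reassoc_of% distribL_tensor]
  rw [tensorHom_comp_tensorHom_assoc, Category.comp_id, Category.id_comp]
  have e3 : μ H V W ⊗ₘ sumMu h X Y =
      (𝟙 (H.obj V ⊗ H.obj W) ⊗ₘ sumMu h X Y) ≫ (μ H V W ⊗ₘ 𝟙 _) := by
    rw [tensorHom_comp_tensorHom, Category.comp_id, Category.id_comp]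
  rw [e3, Category.assoc, reassoc_of% (mu_assoc' (H := H)), ← id_tensorHom_id (H.obj V) (H.obj W),
    associator_naturality_assoc, ← μ_natural_assoc, H.map_id, tensorHom_comp_tensorHom_assoc,
    tensorHom_comp_tensorHom_assoc]
  simp only [Category.assoc, Category.comp_id]
  rw [t.hL]
  have e4 : 𝟙 (H.obj V) ⊗ₘ
      (distribL (H.obj W) (H.obj X) (H.obj Y)).hom ≫ (μ H W X ⊕ₕ μ H W Y) ≫
        sumMu h (W ⊗ X) (W ⊗ Y) =
      (𝟙 (H.obj V) ⊗ₘ (distribL (H.obj W) (H.obj X) (H.obj Y)).hom) ≫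
      (𝟙 (H.obj V) ⊗ₘ (μ H W X ⊕ₕ μ H W Y)) ≫ (𝟙 (H.obj V) ⊗ₘ sumMu h (W ⊗ X) (W ⊗ Y)) := by
    simp
  rw [e4]
  simp only [Category.assoc]
  rw [t.hL, reassoc_of% e2, sumHom_comp_assoc]
  simp only [id_tensorHom]

theorem tr_R_tensor (X Y V W : B) :
    (t.dR X Y V).hom ▷ W ≫ (t.dR (X ⊗ V) (Y ⊗ V) W).hom ≫
        ((α_ X V W).hom ⊕ₕ (α_ Y V W).hom) =
      (α_ (X ⊕ₐ Y) V W).hom ≫ (t.dR X Y (V ⊗ W)).hom := by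
  have iA := @isIso A _ _
  apply H.map_injective
  have e1 := distribR_naturality (μ H X V) (μ H Y V) (𝟙 (H.obj W))
  have e2 := distribR_naturality (𝟙 (H.obj X)) (𝟙 (H.obj Y)) (μ H V W)
  rw [sumHom_id] at e2
  rw [← cancel_epi (((sumMu h X Y ⊗ₘ 𝟙 (H.obj V)) ⊗ₘ 𝟙 (H.obj W)) ≫ (μ H (X ⊕ₐ Y) V ⊗ₘ 𝟙 _) ≫
    μ H ((X ⊕ₐ Y) ⊗ V) W)]
  simp only [Functor.map_comp, Category.assoc, ← tensorHom_id _ W]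
  have e4 : ((distribR (H.obj X) (H.obj Y) (H.obj V)).hom ≫ (μ H X V ⊕ₕ μ H Y V) ≫
        sumMu h (X ⊗ V) (Y ⊗ V)) ⊗ₘ 𝟙 (H.obj W) =
      ((distribR (H.obj X) (H.obj Y) (H.obj V)).hom ⊗ₘ 𝟙 (H.obj W)) ≫
      ((μ H X V ⊕ₕ μ H Y V) ⊗ₘ 𝟙 (H.obj W)) ≫ (sumMu h (X ⊗ V) (Y ⊗ V) ⊗ₘ 𝟙 (H.obj W)) := by
    simp
  calc _ = (((sumMu h X Y ⊗ₘ 𝟙 (H.obj V)) ≫ μ H (X ⊕ₐ Y) V ≫ H.map (t.dR X Y V).hom) ⊗ₘ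
        𝟙 (H.obj W)) ≫ μ H _ _ ≫ H.map (t.dR (X ⊗ V) (Y ⊗ V) W).hom ≫
        H.map ((α_ X V W).hom ⊕ₕ (α_ Y V W).hom) := by
        rw [← μ_natural_assoc, tensorHom_comp_tensorHom_assoc, tensorHom_comp_tensorHom_assoc,
          H.map_id]
        simp only [Category.assoc, Category.comp_id]
    _ = ((distribR (H.obj X) (H.obj Y) (H.obj V)).hom ⊗ₘ 𝟙 (H.obj W)) ≫
        (distribR _ _ _).hom ≫ (((μ H X V ⊗ₘ 𝟙 _) ≫ μ H _ _ ≫ H.map (α_ X V W).hom) ⊕ₕ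
          ((μ H Y V ⊗ₘ 𝟙 _) ≫ μ H _ _ ≫ H.map (α_ Y V W).hom)) ≫ sumMu h _ _ := by
        rw [t.hR, e4]
        simp only [Category.assoc]
        rw [reassoc_of% t.hR, reassoc_of% e1, ← sumMu_naturality, sumHom_comp_assoc,
          sumHom_comp_assoc, Category.assoc, Category.assoc]
    _ = _ := by
        rw [mu_assoc', mu_assoc', sumHom_comp, Category.assoc, tensorHom_id,
          reassoc_of% distribR_tensor, reassoc_of% (mu_assoc' (H := H)),
          associator_naturality_assoc, id_tensorHom_id]
        have e5 : (sumMu h X Y ⊗ₘ 𝟙 (H.obj V ⊗ H.obj W)) ≫ (𝟙 _ ⊗ₘ μ H V W) =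
          (𝟙 _ ⊗ₘ μ H V W) ≫ (sumMu h X Y ⊗ₘ 𝟙 _) := by
          simp only [tensorHom_comp_tensorHom, Category.comp_id, Category.id_comp]
        rw [reassoc_of% e5, t.hR, reassoc_of% e2, sumHom_comp_assoc]

theorem tr_LR (V X Y W : B) :
    (t.dL V X Y).hom ▷ W ≫ (t.dR (V ⊗ X) (V ⊗ Y) W).hom ≫
        ((α_ V X W).hom ⊕ₕ (α_ V Y W).hom) =
      (α_ V (X ⊕ₐ Y) W).hom ≫ V ◁ (t.dR X Y W).hom ≫ (t.dL V (X ⊗ W) (Y ⊗ W)).hom := by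
  have iA := @isIso A _ _
  apply H.map_injective
  have e1 := distribR_naturality (μ H V X) (μ H V Y) (𝟙 (H.obj W))
  have e2 := distribL_naturality (𝟙 (H.obj V)) (μ H X W) (μ H Y W)
  rw [← cancel_epi (((𝟙 (H.obj V) ⊗ₘ sumMu h X Y) ⊗ₘ 𝟙 (H.obj W)) ≫ (μ H V (X ⊕ₐ Y) ⊗ₘ 𝟙 _) ≫
    μ H (V ⊗ (X ⊕ₐ Y)) W)]
  simp only [Functor.map_comp, Category.assoc, ← tensorHom_id _ W, ← id_tensorHom V]
  have e4 : ((distribL (H.obj V) (H.obj X) (H.obj Y)).hom ≫ (μ H V X ⊕ₕ μ H V Y) ≫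
        sumMu h (V ⊗ X) (V ⊗ Y)) ⊗ₘ 𝟙 (H.obj W) =
      ((distribL (H.obj V) (H.obj X) (H.obj Y)).hom ⊗ₘ 𝟙 (H.obj W)) ≫
      ((μ H V X ⊕ₕ μ H V Y) ⊗ₘ 𝟙 (H.obj W)) ≫ (sumMu h (V ⊗ X) (V ⊗ Y) ⊗ₘ 𝟙 (H.obj W)) := by
    simp
  have e5 : 𝟙 (H.obj V) ⊗ₘ ((distribR (H.obj X) (H.obj Y) (H.obj W)).hom ≫
        (μ H X W ⊕ₕ μ H Y W) ≫ sumMu h (X ⊗ W) (Y ⊗ W)) =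
      (𝟙 (H.obj V) ⊗ₘ (distribR (H.obj X) (H.obj Y) (H.obj W)).hom) ≫
      (𝟙 (H.obj V) ⊗ₘ (μ H X W ⊕ₕ μ H Y W)) ≫ (𝟙 (H.obj V) ⊗ₘ sumMu h (X ⊗ W) (Y ⊗ W)) := by
    simp
  calc _ = (((𝟙 (H.obj V) ⊗ₘ sumMu h X Y) ≫ μ H V (X ⊕ₐ Y) ≫ H.map (t.dL V X Y).hom) ⊗ₘ
        𝟙 (H.obj W)) ≫ μ H _ _ ≫ H.map (t.dR (V ⊗ X) (V ⊗ Y) W).hom ≫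
        H.map ((α_ V X W).hom ⊕ₕ (α_ V Y W).hom) := by
        rw [← μ_natural_assoc, tensorHom_comp_tensorHom_assoc, tensorHom_comp_tensorHom_assoc,
          H.map_id]
        simp only [Category.assoc, Category.comp_id]
    _ = ((distribL (H.obj V) (H.obj X) (H.obj Y)).hom ⊗ₘ 𝟙 (H.obj W)) ≫
        (distribR _ _ _).hom ≫ (((μ H V X ⊗ₘ 𝟙 _) ≫ μ H _ _ ≫ H.map (α_ V X W).hom) ⊕ₕ
          ((μ H V Y ⊗ₘ 𝟙 _) ≫ μ H _ _ ≫ H.map (α_ V Y W).hom)) ≫ sumMu h _ _ := by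
        rw [t.hL, e4]
        simp only [Category.assoc]
        rw [reassoc_of% t.hR, reassoc_of% e1, ← sumMu_naturality, sumHom_comp_assoc,
          sumHom_comp_assoc, Category.assoc, Category.assoc]
    _ = (α_ _ _ _).hom ≫ (𝟙 (H.obj V) ⊗ₘ ((sumMu h X Y ⊗ₘ 𝟙 _) ≫ μ H _ _ ≫
          H.map (t.dR X Y W).hom)) ≫ μ H _ _ ≫ H.map (t.dL V (X ⊗ W) (Y ⊗ W)).hom := by
        rw [mu_assoc', mu_assoc', sumHom_comp, Category.assoc, tensorHom_id,
          reassoc_of% distribL_distribR_assoc, t.hR, e5]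
        simp only [Category.assoc]
        rw [t.hL, reassoc_of% e2, sumHom_comp_assoc]
        simp only [id_tensorHom]
    _ = _ := by
        rw [reassoc_of% (mu_assoc' (H := H)), associator_naturality_assoc, ← μ_natural_assoc,
          tensorHom_comp_tensorHom_assoc, tensorHom_comp_tensorHom_assoc, H.map_id]
        simp only [Category.assoc, Category.comp_id]

theorem tr_exchange (V W X Y : B) :
    (t.dL (V ⊕ₐ W) X Y).hom ≫ ((t.dR V W X).hom ⊕ₕ (t.dR V W Y).hom) ≫
        sumExchange (V ⊗ X) (W ⊗ X) (V ⊗ Y) (W ⊗ Y) =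
      (t.dR V W (X ⊕ₐ Y)).hom ≫ ((t.dL V X Y).hom ⊕ₕ (t.dL W X Y).hom) := by
  have iA := @isIso A _ _
  apply H.map_injective
  have e1 := distribL_naturality (sumMu h V W) (𝟙 (H.obj X)) (𝟙 (H.obj Y))
  have e2 := distribR_naturality (𝟙 (H.obj V)) (𝟙 (H.obj W)) (sumMu h X Y)
  rw [sumHom_id] at e1 e2
  have e3 : (sumMu h V W ⊗ₘ 𝟙 (H.obj X ⊕ₐ H.obj Y)) ≫ (𝟙 (H.obj (V ⊕ₐ W)) ⊗ₘ sumMu h X Y) =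
      (𝟙 (H.obj V ⊕ₐ H.obj W) ⊗ₘ sumMu h X Y) ≫ (sumMu h V W ⊗ₘ 𝟙 (H.obj (X ⊕ₐ Y))) := by
    simp only [tensorHom_comp_tensorHom, Category.comp_id, Category.id_comp]
  rw [← cancel_epi ((sumMu h V W ⊗ₘ 𝟙 (H.obj X ⊕ₐ H.obj Y)) ≫
    (𝟙 (H.obj (V ⊕ₐ W)) ⊗ₘ sumMu h X Y) ≫ μ H (V ⊕ₐ W) (X ⊕ₐ Y))]
  simp only [Functor.map_comp, Category.assoc]
  conv_rhs => rw [reassoc_of% e3]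
  have s3 : ∀ {X Y Z W X' Y' Z' W' : A} (f : X ⟶ Y) (g : Y ⟶ Z) (k : Z ⟶ W) (f' : X' ⟶ Y')
      (g' : Y' ⟶ Z') (k' : Z' ⟶ W'), (f ≫ g ≫ k) ⊕ₕ (f' ≫ g' ≫ k') =
      (f ⊕ₕ f') ≫ (g ⊕ₕ g') ≫ (k ⊕ₕ k') := by
    intros
    simp only [sumHom_comp]
  rw [reassoc_of% t.hL, reassoc_of% e1, ← reassoc_of% (sumMu_naturality h), sumHom_comp_assoc,
    sumHom_comp_assoc]
  rw [reassoc_of% t.hR, reassoc_of% e2, ← sumMu_naturality, sumHom_comp_assoc,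
    sumHom_comp_assoc]
  simp only [Category.assoc]
  rw [t.hR, t.hR, t.hL, t.hL, s3, s3]
  simp only [Category.assoc]
  rw [← sumMu_exchange, reassoc_of% sumExchange_naturality, reassoc_of% distribL_distribR_exchange]

theorem tr_L_one (X Y : B) :
    (t.dL (𝟙_ B) X Y).hom ≫ ((λ_ X).hom ⊕ₕ (λ_ Y).hom) = (λ_ (X ⊕ₐ Y)).hom := by
  have iA := @isIso A _ _
  apply H.map_injective
  have e1 := distribL_naturality (ε H) (𝟙 (H.obj X)) (𝟙 (H.obj Y))
  rw [sumHom_id] at e1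
  have u : ∀ X : B, (ε H ⊗ₘ 𝟙 (H.obj X)) ≫ μ H (𝟙_ B) X ≫ H.map (λ_ X).hom = (λ_ (H.obj X)).hom := by
    intro X
    rw [left_unitality, tensorHom_id]
  have e3 : (ε H ⊗ₘ 𝟙 (H.obj X ⊕ₐ H.obj Y)) ≫ (𝟙 (H.obj (𝟙_ B)) ⊗ₘ sumMu h X Y) =
      (𝟙 (𝟙_ A) ⊗ₘ sumMu h X Y) ≫ (ε H ⊗ₘ 𝟙 (H.obj (X ⊕ₐ Y))) := by
    simp only [tensorHom_comp_tensorHom, Category.comp_id, Category.id_comp]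
  rw [← cancel_epi ((ε H ⊗ₘ 𝟙 (H.obj X ⊕ₐ H.obj Y)) ≫
    (𝟙 (H.obj (𝟙_ B)) ⊗ₘ sumMu h X Y) ≫ μ H (𝟙_ B) (X ⊕ₐ Y))]
  simp only [Functor.map_comp, Category.assoc]
  conv_rhs => rw [reassoc_of% e3]
  rw [reassoc_of% t.hL, reassoc_of% e1, ← sumMu_naturality, sumHom_comp_assoc,
    sumHom_comp_assoc, Category.assoc, Category.assoc, u, u, u, reassoc_of% distribL_one,
    id_tensorHom, leftUnitor_naturality]

theorem tr_R_one (X Y : B) :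
    (t.dR X Y (𝟙_ B)).hom ≫ ((ρ_ X).hom ⊕ₕ (ρ_ Y).hom) = (ρ_ (X ⊕ₐ Y)).hom := by
  have iA := @isIso A _ _
  apply H.map_injective
  have e1 := distribR_naturality (𝟙 (H.obj X)) (𝟙 (H.obj Y)) (ε H)
  rw [sumHom_id] at e1
  have u : ∀ X : B, (𝟙 (H.obj X) ⊗ₘ ε H) ≫ μ H X (𝟙_ B) ≫ H.map (ρ_ X).hom = (ρ_ (H.obj X)).hom := by
    intro X
    rw [right_unitality, id_tensorHom]
  have e3 : (𝟙 (H.obj X ⊕ₐ H.obj Y) ⊗ₘ ε H) ≫ (sumMu h X Y ⊗ₘ 𝟙 (H.obj (𝟙_ B))) =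
      (sumMu h X Y ⊗ₘ 𝟙 (𝟙_ A)) ≫ (𝟙 (H.obj (X ⊕ₐ Y)) ⊗ₘ ε H) := by
    simp only [tensorHom_comp_tensorHom, Category.comp_id, Category.id_comp]
  rw [← cancel_epi ((𝟙 (H.obj X ⊕ₐ H.obj Y) ⊗ₘ ε H) ≫
    (sumMu h X Y ⊗ₘ 𝟙 (H.obj (𝟙_ B))) ≫ μ H (X ⊕ₐ Y) (𝟙_ B))]
  simp only [Functor.map_comp, Category.assoc]
  conv_rhs => rw [reassoc_of% e3]
  rw [reassoc_of% t.hR, reassoc_of% e1, ← sumMu_naturality, sumHom_comp_assoc,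
    sumHom_comp_assoc, Category.assoc, Category.assoc, u, u, u, reassoc_of% distribR_one,
    tensorHom_id, rightUnitor_naturality]

end Laws

/-- Transport of an Ann-category structure along a faithful functor monoidal for both operations. -/
@[reducible]
def DistribTransport.annCategory : AnnCategory B where
  distribL := t.dL
  distribR := t.dR
  distribL_naturality := tr_natL t
  distribR_naturality := tr_natR t
  distribL_assoc := tr_L_assoc t
  distribL_comm := tr_L_comm t
  distribR_assoc := tr_R_assoc t
  distribR_comm := tr_R_comm t
  distribL_tensor := tr_L_tensor t
  distribR_tensor := tr_R_tensor t
  distribL_distribR_assoc := tr_LR t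
  distribL_distribR_exchange := tr_exchange t
  distribL_one := tr_L_one t
  distribR_one := tr_R_one t

end Transport
end Functors

section BraidedTransport

open Functor.LaxMonoidal AnnCategory BraidedAnnCategory

variable {A : Type u₁} [Category.{v₁} A] {B : Type u₂} [Category.{v₂} B]
  [MonoidalCategory A] [BraidedCategory A] [SumStructure A] [BraidedAnnCategory A]
  [MonoidalCategory B] [BraidedCategory B] [SumStructure B]

theorem braiding_self_of_iso_zero {X : A} (e : zeroObj A ⟶ X) : (β_ X X).hom = 𝟙 _ := by
  have := isIso A e
  rw [← cancel_epi (e ⊗ₘ e), BraidedCategory.braiding_naturality, braiding_zero]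
  simp

/-- Transport of a braided Ann-category structure along a faithful functor. -/
@[reducible]
def DistribTransport.braidedAnnCategory {H : B ⥤ A} [H.Faithful] [H.Braided] {h : SumFunctor H}
    (t : DistribTransport H h) : BraidedAnnCategory B :=
  { t.annCategory with
    braiding_distrib := fun X Y Z => by
      have iA := @isIso A _ _
      apply H.map_injective
      rw [← cancel_epi ((𝟙 (H.obj X) ⊗ₘ sumMu h Y Z) ≫ μ H X (Y ⊕ₐ Z))]
      have hL := t.hL X Y Z
      have hR := t.hR Y Z X
      change _ ≫ H.map ((t.dL X Y Z).hom ≫ _) = _ ≫ H.map (_ ≫ (t.dR Y Z X).hom)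
      simp only [CategoryTheory.Functor.map_comp, Category.assoc]
      rw [reassoc_of% hL, ← sumMu_naturality, sumHom_comp_assoc, Functor.LaxBraided.braided,
        Functor.LaxBraided.braided, sumHom_comp, Category.assoc, reassoc_of% braiding_distrib,
        reassoc_of% (Functor.LaxBraided.braided (F := H)),
        BraidedCategory.braiding_naturality_assoc, hR]
    braiding_zero := by
      apply H.map_injective
      rw [← cancel_epi (μ H (zeroObj B) (zeroObj B)), Functor.LaxBraided.braided,
        braiding_self_of_iso_zero (sumEps h)]
      simp }

end BraidedTransport

section SumComp

variable {A : Type u₁} [Category.{v₁} A] [SumStructure A]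
  {B : Type u₂} [Category.{v₂} B] [SumStructure B]
  {C : Type u₃} [Category.{v₃} C] [SumStructure C]

/-- The composite of the structures for the sums. -/
@[reducible]
def sumFunctorComp {F : A ⥤ B} {G : B ⥤ C} (hF : SumFunctor F) (hG : SumFunctor G) :
    SumFunctor (F ⋙ G) :=
  @Functor.Braided.instComp A _ SumStructure.monoidal (SumStructure.braided A)
    B _ SumStructure.monoidal (SumStructure.braided B)
    C _ SumStructure.monoidal (SumStructure.braided C) F G hF hG

theorem sumMu_comp {F : A ⥤ B} {G : B ⥤ C} (hF : SumFunctor F) (hG : SumFunctor G) (X Y : A) :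
    sumMu (sumFunctorComp hF hG) X Y =
      sumMu hG (F.obj X) (F.obj Y) ≫ G.map (sumMu hF X Y) := rfl

end SumComp

section BraidedAnnFunctor

open Functor.LaxMonoidal AnnCategory

/-- A braided Ann-functor: a functor with structures of symmetric monoidal functor for `⊕` and for
`⊗`, compatible with the distributivity constraints. -/
structure BraidedAnnFunctor (A : Type u₁) [Category.{v₁} A] [MonoidalCategory A]
    [BraidedCategory A] [SumStructure A] [BraidedAnnCategory A]
    (B : Type u₂) [Category.{v₂} B] [MonoidalCategory B]
    [BraidedCategory B] [SumStructure B] [BraidedAnnCategory B] where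
  functor : A ⥤ B
  add : SumFunctor functor
  [mul : functor.Braided]
  map_distribL : ∀ X Y Z : A,
    (𝟙 (functor.obj X) ⊗ₘ sumMu add Y Z) ≫ μ functor X (Y ⊕ₐ Z) ≫
        functor.map (distribL X Y Z).hom =
      (distribL (functor.obj X) (functor.obj Y) (functor.obj Z)).hom ≫
        (μ functor X Y ⊕ₕ μ functor X Z) ≫ sumMu add (X ⊗ Y) (X ⊗ Z)
  map_distribR : ∀ X Y Z : A,
    (sumMu add X Y ⊗ₘ 𝟙 (functor.obj Z)) ≫ μ functor (X ⊕ₐ Y) Z ≫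
        functor.map (distribR X Y Z).hom =
      (distribR (functor.obj X) (functor.obj Y) (functor.obj Z)).hom ≫
        (μ functor X Z ⊕ₕ μ functor Y Z) ≫ sumMu add (X ⊗ Z) (Y ⊗ Z)

attribute [instance] BraidedAnnFunctor.mul

namespace BraidedAnnFunctor

variable {A : Type u₁} [Category.{v₁} A] [MonoidalCategory A] [BraidedCategory A]
  [SumStructure A] [BraidedAnnCategory A]
  {B : Type u₂} [Category.{v₂} B] [MonoidalCategory B] [BraidedCategory B]
  [SumStructure B] [BraidedAnnCategory B]
  {C : Type u₃} [Category.{v₃} C] [MonoidalCategory C] [BraidedCategory C]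
  [SumStructure C] [BraidedAnnCategory C]

/-- The identity braided Ann-functor. -/
def id (A : Type u₁) [Category.{v₁} A] [MonoidalCategory A] [BraidedCategory A]
    [SumStructure A] [BraidedAnnCategory A] : BraidedAnnFunctor A A where
  functor := 𝟭 A
  add := @Functor.Braided.instId A _ SumStructure.monoidal (SumStructure.braided A)
  map_distribL X Y Z := by
    have h : ∀ X Y : A, sumMu (@Functor.Braided.instId A _ SumStructure.monoidal
      (SumStructure.braided A)) X Y = 𝟙 (X ⊕ₐ Y) := fun _ _ => rfl
    rw [h, h]
    simp
  map_distribR X Y Z := by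
    have h : ∀ X Y : A, sumMu (@Functor.Braided.instId A _ SumStructure.monoidal
      (SumStructure.braided A)) X Y = 𝟙 (X ⊕ₐ Y) := fun _ _ => rfl
    rw [h, h]
    simp

/-- The composite `G ∘ F` of braided Ann-functors. -/
def comp (F : BraidedAnnFunctor A B) (G : BraidedAnnFunctor B C) : BraidedAnnFunctor A C where
  functor := F.functor ⋙ G.functor
  add := sumFunctorComp F.add G.add
  map_distribL X Y Z := by
    have hF := congrArg G.functor.map (F.map_distribL X Y Z)
    have hG := G.map_distribL (F.functor.obj X) (F.functor.obj Y) (F.functor.obj Z)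
    simp only [CategoryTheory.Functor.map_comp] at hF
    rw [sumMu_comp, sumMu_comp, comp_μ, comp_μ, comp_μ]
    dsimp only [Functor.comp_obj, Functor.comp_map]
    rw [← Category.id_comp (𝟙 (G.functor.obj (F.functor.obj X))),
      ← tensorHom_comp_tensorHom, ← G.functor.map_id (F.functor.obj X)]
    simp only [Category.assoc]
    rw [μ_natural_assoc, hF, G.functor.map_id, reassoc_of% hG,
      ← reassoc_of% (sumMu_naturality G.add), sumHom_comp_assoc]
  map_distribR X Y Z := by
    have hF := congrArg G.functor.map (F.map_distribR X Y Z)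
    have hG := G.map_distribR (F.functor.obj X) (F.functor.obj Y) (F.functor.obj Z)
    simp only [CategoryTheory.Functor.map_comp] at hF
    rw [sumMu_comp, sumMu_comp, comp_μ, comp_μ, comp_μ]
    dsimp only [Functor.comp_obj, Functor.comp_map]
    rw [← Category.id_comp (𝟙 (G.functor.obj (F.functor.obj Z))),
      ← tensorHom_comp_tensorHom, ← G.functor.map_id (F.functor.obj Z)]
    simp only [Category.assoc]
    rw [μ_natural_assoc, hF, G.functor.map_id, reassoc_of% hG,
      ← reassoc_of% (sumMu_naturality G.add), sumHom_comp_assoc]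

/-- A natural transformation of braided Ann-functors is a braided Ann-morphism (a homotopy) when
it is monoidal for `⊕` and for `⊗`. -/
def IsAnnMorphism (F G : BraidedAnnFunctor A B) (τ : F.functor ⟶ G.functor) : Prop :=
  @NatTrans.IsMonoidal A _ SumStructure.monoidal B _ SumStructure.monoidal F.functor G.functor τ
    (sumLax F.add) (sumLax G.add) ∧ NatTrans.IsMonoidal τ

/-- A braided Ann-functor `F : A ⥤ B` is a braided Ann-equivalence when there are a braided
Ann-functor `K : B ⥤ A` and invertible braided Ann-morphisms `K ∘ F ≅ id` and `F ∘ K ≅ id`. -/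
def IsAnnEquivalence (F : BraidedAnnFunctor A B) : Prop :=
  ∃ (K : BraidedAnnFunctor B A) (η : (F.comp K).functor ≅ (BraidedAnnFunctor.id A).functor)
    (θ : (K.comp F).functor ≅ (BraidedAnnFunctor.id B).functor),
    IsAnnMorphism (F.comp K) (BraidedAnnFunctor.id A) η.hom ∧
      IsAnnMorphism (K.comp F) (BraidedAnnFunctor.id B) θ.hom

end BraidedAnnFunctor

section Inverse

section Generic

variable {C : Type u₁} [Category.{v₁} C] [MonoidalCategory C] [BraidedCategory C]
  {D : Type u₂} [Category.{v₂} D] [MonoidalCategory D] [BraidedCategory D]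

theorem mu_inverse_aux {C : Type u₁} [Category.{v₁} C] [MonoidalCategory C] {D : Type u₂}
    [Category.{v₂} D] [MonoidalCategory D] (e : C ≌ D) [e.functor.Monoidal] [e.inverse.Monoidal] [e.IsMonoidal]
    (X Y : D) : μ e.functor (e.inverse.obj X) (e.inverse.obj Y) ≫
      e.functor.map (μ e.inverse X Y) ≫ e.counitIso.hom.app (X ⊗ Y) =
        (e.counitIso.hom.app X ⊗ₘ e.counitIso.hom.app Y) := by
  rw [e.functor_map_μ_inverse_comp_counitIso_hom_app_tensor, Functor.Monoidal.μ_δ_assoc]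

/-- The inverse of a braided equivalence is braided. -/
@[reducible]
noncomputable def inverseBraided (e : C ≌ D) (h : e.functor.Braided) : e.inverse.Braided :=
  letI i1 : e.inverse.Monoidal := e.inverseMonoidal
  haveI : e.IsMonoidal := e.toAdjunction.instIsMonoidal
  { i1 with
    braided := fun X Y => by
      apply e.functor.map_injective
      rw [← cancel_epi (μ e.functor _ _), ← cancel_mono (e.counitIso.hom.app (Y ⊗ X)),
        Functor.map_comp, Functor.map_comp]
      have h1 := e.counitIso.hom.naturality (β_ X Y).hom
      simp only [Functor.comp_map, Functor.id_map] at h1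
      simp only [Category.assoc]
      rw [h1, reassoc_of% (mu_inverse_aux e), reassoc_of% (Functor.LaxBraided.braided
        (F := e.functor)), mu_inverse_aux, BraidedCategory.braiding_naturality] }

theorem mu_inverseBraided (e : C ≌ D) (h : e.functor.Braided) (X Y : D) :
    μ e.functor (e.inverse.obj X) (e.inverse.obj Y) ≫
      e.functor.map (@Functor.LaxMonoidal.μ _ _ _ _ _ _ e.inverse
        (inverseBraided e h).toMonoidal.toLaxMonoidal X Y) ≫ e.counitIso.hom.app (X ⊗ Y) =
        (e.counitIso.hom.app X ⊗ₘ e.counitIso.hom.app Y) :=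
  letI : e.inverse.Monoidal := e.inverseMonoidal
  haveI : e.IsMonoidal := e.toAdjunction.instIsMonoidal
  mu_inverse_aux e X Y

end Generic

variable {A : Type u₁} [Category.{v₁} A] [MonoidalCategory A] [BraidedCategory A]
  [SumStructure A] [BraidedAnnCategory A]
  {B : Type u₂} [Category.{v₂} B] [MonoidalCategory B] [BraidedCategory B]
  [SumStructure B] [BraidedAnnCategory B]

/-- The inverse structure for the sums. -/
@[reducible]
noncomputable def sumInverse {A : Type u₁} [Category.{v₁} A] [SumStructure A]
    {B : Type u₂} [Category.{v₂} B] [SumStructure B] (e : A ≌ B) (h : SumFunctor e.functor) :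
    SumFunctor e.inverse :=
  @inverseBraided A _ SumStructure.monoidal (SumStructure.braided A)
    B _ SumStructure.monoidal (SumStructure.braided B) e h

theorem sumMu_sumInverse {A : Type u₁} [Category.{v₁} A] [SumStructure A]
    {B : Type u₂} [Category.{v₂} B] [SumStructure B] (e : A ≌ B) (h : SumFunctor e.functor)
    (X Y : B) : sumMu h (e.inverse.obj X) (e.inverse.obj Y) ≫
      e.functor.map (sumMu (sumInverse e h) X Y) ≫ e.counitIso.hom.app (X ⊕ₐ Y) =
        (e.counitIso.hom.app X ⊕ₕ e.counitIso.hom.app Y) :=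
  @mu_inverseBraided A _ SumStructure.monoidal (SumStructure.braided A)
    B _ SumStructure.monoidal (SumStructure.braided B) e h X Y

theorem map_distribL_inverse (e : A ≌ B) (h : SumFunctor e.functor)
    (m : e.functor.Braided)
    (hL : ∀ X Y Z : A,
      (𝟙 (e.functor.obj X) ⊗ₘ sumMu h Y Z) ≫ μ e.functor X (Y ⊕ₐ Z) ≫
          e.functor.map (distribL X Y Z).hom =
        (distribL (e.functor.obj X) (e.functor.obj Y) (e.functor.obj Z)).hom ≫
          (μ e.functor X Y ⊕ₕ μ e.functor X Z) ≫ sumMu h (X ⊗ Y) (X ⊗ Z)) (X Y Z : B) :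
    letI := inverseBraided e m
    (𝟙 (e.inverse.obj X) ⊗ₘ sumMu (sumInverse e h) Y Z) ≫ μ e.inverse X (Y ⊕ₐ Z) ≫
        e.inverse.map (distribL X Y Z).hom =
      (distribL (e.inverse.obj X) (e.inverse.obj Y) (e.inverse.obj Z)).hom ≫
        (μ e.inverse X Y ⊕ₕ μ e.inverse X Z) ≫ sumMu (sumInverse e h) (X ⊗ Y) (X ⊗ Z) := by
  let _ := inverseBraided e m
  have iB := @isIso B _ _
  have key : ∀ X Y : B, μ e.functor (e.inverse.obj X) (e.inverse.obj Y) ≫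
      e.functor.map (μ e.inverse X Y) ≫ e.counitIso.hom.app (X ⊗ Y) =
        (e.counitIso.hom.app X ⊗ₘ e.counitIso.hom.app Y) := mu_inverseBraided e m
  have key2 := sumMu_sumInverse e h
  have nat : ∀ {X Y : B} (f : X ⟶ Y), e.functor.map (e.inverse.map f) ≫ e.counitIso.hom.app Y =
    e.counitIso.hom.app X ≫ f := fun f => e.counitIso.hom.naturality f
  apply e.functor.map_injective
  rw [← cancel_epi ((𝟙 _ ⊗ₘ sumMu h _ _) ≫ μ e.functor _ _), ← cancel_mono (e.counitIso.hom.app _)]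
  simp only [CategoryTheory.Functor.map_comp, Category.assoc]
  rw [nat, reassoc_of% hL, ← reassoc_of% (sumMu_naturality h), key2, ← sumHom_comp, ← sumHom_comp, key, key, ← distribL_naturality, ← μ_natural_assoc, reassoc_of% key,
    tensorHom_comp_tensorHom_assoc, tensorHom_comp_tensorHom_assoc]
  simp only [Category.assoc]
  rw [key2]
  simp

theorem map_distribR_inverse (e : A ≌ B) (h : SumFunctor e.functor)
    (m : e.functor.Braided)
    (hR : ∀ X Y Z : A,
      (sumMu h X Y ⊗ₘ 𝟙 (e.functor.obj Z)) ≫ μ e.functor (X ⊕ₐ Y) Z ≫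
          e.functor.map (distribR X Y Z).hom =
        (distribR (e.functor.obj X) (e.functor.obj Y) (e.functor.obj Z)).hom ≫
          (μ e.functor X Z ⊕ₕ μ e.functor Y Z) ≫ sumMu h (X ⊗ Z) (Y ⊗ Z)) (X Y Z : B) :
    letI := inverseBraided e m
    (sumMu (sumInverse e h) X Y ⊗ₘ 𝟙 (e.inverse.obj Z)) ≫ μ e.inverse (X ⊕ₐ Y) Z ≫
        e.inverse.map (distribR X Y Z).hom =
      (distribR (e.inverse.obj X) (e.inverse.obj Y) (e.inverse.obj Z)).hom ≫
        (μ e.inverse X Z ⊕ₕ μ e.inverse Y Z) ≫ sumMu (sumInverse e h) (X ⊗ Z) (Y ⊗ Z) := by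
  let _ := inverseBraided e m
  have iB := @isIso B _ _
  have key : ∀ X Y : B, μ e.functor (e.inverse.obj X) (e.inverse.obj Y) ≫
      e.functor.map (μ e.inverse X Y) ≫ e.counitIso.hom.app (X ⊗ Y) =
        (e.counitIso.hom.app X ⊗ₘ e.counitIso.hom.app Y) := mu_inverseBraided e m
  have key2 := sumMu_sumInverse e h
  have nat : ∀ {X Y : B} (f : X ⟶ Y), e.functor.map (e.inverse.map f) ≫ e.counitIso.hom.app Y =
    e.counitIso.hom.app X ≫ f := fun f => e.counitIso.hom.naturality f
  apply e.functor.map_injective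
  rw [← cancel_epi ((sumMu h _ _ ⊗ₘ 𝟙 _) ≫ μ e.functor _ _), ← cancel_mono (e.counitIso.hom.app _)]
  simp only [CategoryTheory.Functor.map_comp, Category.assoc]
  rw [nat, reassoc_of% hR, ← reassoc_of% (sumMu_naturality h), key2, ← sumHom_comp, ← sumHom_comp, key, key, ← distribR_naturality, ← μ_natural_assoc, reassoc_of% key,
    tensorHom_comp_tensorHom_assoc, tensorHom_comp_tensorHom_assoc]
  simp only [Category.assoc]
  rw [key2]
  simp

/-- The functor `G` inverse to a braided Ann-functor `F`, with the structure of braided Ann-functor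
for which the unit `η` and the counit `θ` are monoidal for `⊕` and for `⊗`. -/
noncomputable def BraidedAnnFunctor.inverse (F : BraidedAnnFunctor A B) (G : B ⥤ A)
    (η : 𝟭 A ≅ F.functor ⋙ G) (θ : G ⋙ F.functor ≅ 𝟭 B)
    (tri : ∀ X : A, F.functor.map (η.hom.app X) ≫ θ.hom.app (F.functor.obj X) = 𝟙 _) :
    BraidedAnnFunctor B A where
  functor := G
  add := sumInverse ⟨F.functor, G, η, θ, tri⟩ F.add
  mul := inverseBraided ⟨F.functor, G, η, θ, tri⟩ F.mul
  map_distribL := map_distribL_inverse ⟨F.functor, G, η, θ, tri⟩ F.add F.mul F.map_distribL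
  map_distribR := map_distribR_inverse ⟨F.functor, G, η, θ, tri⟩ F.add F.mul F.map_distribR

end Inverse
end BraidedAnnFunctor

section Induced

variable {C : Type u₁} [Category.{v₁} C] [MonoidalCategory C] {D : Type u₂} [Category.{v₂} D]
  (H : D ⥤ C) [H.Full] [H.Faithful] (o : D → D → D) (i : D) (e : 𝟙_ C ≅ H.obj i)
  (m : ∀ X Y, H.obj X ⊗ H.obj Y ≅ H.obj (o X Y))

/-- The operations and constraints on `D` which correspond to those of `C` under a fully faithful
functor `H : D ⥤ C` and isomorphisms `m : H X ⊗ H Y ≅ H (o X Y)`, `e : 1 ≅ H i`. -/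
@[reducible]
noncomputable def inducedStruct : MonoidalCategoryStruct D where
  tensorObj := o
  tensorUnit := i
  whiskerLeft X _ _ f := H.preimage ((m _ _).inv ≫ (H.obj X ◁ H.map f) ≫ (m _ _).hom)
  whiskerRight f X := H.preimage ((m _ _).inv ≫ (H.map f ▷ H.obj X) ≫ (m _ _).hom)
  tensorHom f g := H.preimage ((m _ _).inv ≫ (H.map f ⊗ₘ H.map g) ≫ (m _ _).hom)
  associator X Y Z := H.preimageIso (((m _ _).symm ≪≫ ((m _ _).symm ⊗ᵢ .refl _)) ≪≫
    α_ (H.obj X) (H.obj Y) (H.obj Z) ≪≫ ((.refl _ ⊗ᵢ m _ _) ≪≫ m _ _))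
  leftUnitor X := H.preimageIso (((m _ _).symm ≪≫ (e.symm ⊗ᵢ .refl _)) ≪≫ λ_ (H.obj X))
  rightUnitor X := H.preimageIso (((m _ _).symm ≪≫ (.refl _ ⊗ᵢ e.symm)) ≪≫ ρ_ (H.obj X))

/-- The functor `H` with the isomorphisms `m`, `e` carries the induced operations and constraints
to those of `C`. -/
@[reducible]
noncomputable def inducedData :
    letI := inducedStruct H o i e m
    Monoidal.InducingFunctorData H :=
  letI := inducedStruct H o i e m
  { μIso := m
    εIso := e
    whiskerLeft_eq := fun _ _ _ _ => H.map_preimage _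
    whiskerRight_eq := fun _ _ => H.map_preimage _
    tensorHom_eq := fun _ _ => H.map_preimage _
    associator_eq := fun _ _ _ => H.map_preimage _
    leftUnitor_eq := fun _ => H.map_preimage _
    rightUnitor_eq := fun _ => H.map_preimage _ }

/-- The induced monoidal category. -/
@[reducible]
noncomputable def inducedMonoidal : MonoidalCategory D :=
  letI := inducedStruct H o i e m
  Monoidal.induced H (inducedData H o i e m)

/-- The monoidal functor structure of `H`, given by `m` and `e`. -/
@[reducible]
noncomputable def inducedFunctor :
    @Functor.Monoidal D _ (inducedMonoidal H o i e m) C _ _ H :=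
  letI := inducedStruct H o i e m
  Monoidal.fromInducedMonoidal H (inducedData H o i e m)

theorem inducedFunctor_mu (X Y : D) :
    @Functor.LaxMonoidal.μ D _ (inducedMonoidal H o i e m) C _ _ H
      (@Functor.Monoidal.toLaxMonoidal D _ (inducedMonoidal H o i e m) C _ _ H
        (inducedFunctor H o i e m)) X Y = (m X Y).hom := rfl

/-- The braiding induced through a fully faithful monoidal functor. -/
@[reducible]
noncomputable def inducedBraided [BraidedCategory C] :
    @BraidedCategory D _ (inducedMonoidal H o i e m) :=
  letI := inducedMonoidal H o i e m
  letI := inducedFunctor H o i e m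
  BraidedCategory.ofFullyFaithful H

/-- The braided functor structure of `H`. -/
@[reducible]
noncomputable def inducedBraidedFunctor [BraidedCategory C] :
    @Functor.Braided D _ (inducedMonoidal H o i e m) (inducedBraided H o i e m) C _ _ _ H :=
  letI := inducedMonoidal H o i e m
  letI i2 := inducedFunctor H o i e m
  letI := inducedBraided H o i e m
  { i2 with
    braided := fun X Y => by
      change (m X Y).hom ≫ H.map (H.preimage ((m X Y).inv ≫ (β_ (H.obj X) (H.obj Y)).hom ≫
        (m Y X).hom)) = (β_ (H.obj X) (H.obj Y)).hom ≫ (m Y X).hom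
      simp }

@[reducible]
noncomputable def inducedSymmetric [SymmetricCategory C] :
    @SymmetricCategory D _ (inducedMonoidal H o i e m) :=
  letI := inducedMonoidal H o i e m
  letI := inducedBraided H o i e m
  letI := inducedBraidedFunctor H o i e m
  SymmetricCategory.ofFaithful H

end Induced

section

open Functor.LaxMonoidal AnnCategory

/-- The distributivity isomorphisms on `B` induced through a fully faithful functor. -/
noncomputable def DistribTransport.ofFullyFaithful {A : Type u₁} [Category.{v₁} A]
    [MonoidalCategory A] [SumStructure A] [AnnCategory A] {B : Type u₂} [Category.{v₂} B]
    [MonoidalCategory B] [SumStructure B] (H : B ⥤ A) [H.Full] [H.Faithful] [H.Monoidal]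
    (h : SumFunctor H) : DistribTransport H h where
  dL X Y Z := H.preimageIso ((@asIso _ _ _ _ ((𝟙 (H.obj X) ⊗ₘ sumMu h Y Z) ≫ μ H X (Y ⊕ₐ Z))
    (isIso A _)).symm ≪≫ distribL (H.obj X) (H.obj Y) (H.obj Z) ≪≫
    @asIso _ _ _ _ ((μ H X Y ⊕ₕ μ H X Z) ≫ sumMu h (X ⊗ Y) (X ⊗ Z)) (isIso A _))
  dR X Y Z := H.preimageIso ((@asIso _ _ _ _ ((sumMu h X Y ⊗ₘ 𝟙 (H.obj Z)) ≫ μ H (X ⊕ₐ Y) Z)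
    (isIso A _)).symm ≪≫ distribR (H.obj X) (H.obj Y) (H.obj Z) ≪≫
    @asIso _ _ _ _ ((μ H X Z ⊕ₕ μ H Y Z) ≫ sumMu h (X ⊗ Z) (Y ⊗ Z)) (isIso A _))
  hL X Y Z := by
    rw [← Category.assoc, Functor.preimageIso_hom, H.map_preimage]
    simp only [Iso.trans_hom, Iso.symm_hom, asIso_inv, asIso_hom]
    rw [IsIso.hom_inv_id_assoc]
  hR X Y Z := by
    rw [← Category.assoc, Functor.preimageIso_hom, H.map_preimage]
    simp only [Iso.trans_hom, Iso.symm_hom, asIso_inv, asIso_hom]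
    rw [IsIso.hom_inv_id_assoc]

end

section Reduced

open Functor.LaxMonoidal AnnCategory

variable {A : Type u} [Category.{v} A] [MonoidalCategory A] [BraidedCategory A] [SumStructure A]
  [BraidedAnnCategory A]

/-- A stick of `A`: representatives `X_s` of the isomorphism classes, with `X_0 = 0` and `X_1 = 1`
(identifications `zero`, `one`), and isomorphisms `φ : X_s ⊕ X_t ≅ X_{s+t}`,
`ψ : X_s ⊗ X_t ≅ X_{st}` with `φ_{0,t} = g`, `φ_{s,0} = d`, `ψ_{1,t} = l`, `ψ_{s,1} = r`,
`ψ_{0,t} = R̂`, `ψ_{s,0} = L̂`. -/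
structure Stick (A : Type u) [Category.{v} A] [MonoidalCategory A] [BraidedCategory A]
    [SumStructure A] [BraidedAnnCategory A] where
  rep : Pi0 A → A
  mk_rep : ∀ s, Pi0.mk (rep s) = s
  zero : zeroObj A ≅ rep 0
  one : 𝟙_ A ≅ rep 1
  φ : ∀ s t, rep s ⊕ₐ rep t ≅ rep (s + t)
  ψ : ∀ s t, rep s ⊗ rep t ≅ rep (s * t)
  φ_zero_left : ∀ t, (zero.hom ⊕ₕ 𝟙 (rep t)) ≫ (φ 0 t).hom ≫ eqToHom (by rw [zero_add]) =
    (zeroSum (rep t)).hom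
  φ_zero_right : ∀ s, (𝟙 (rep s) ⊕ₕ zero.hom) ≫ (φ s 0).hom ≫ eqToHom (by rw [add_zero]) =
    (sumZero (rep s)).hom
  ψ_one_left : ∀ t, one.hom ▷ rep t ≫ (ψ 1 t).hom ≫ eqToHom (by rw [one_mul]) =
    (λ_ (rep t)).hom
  ψ_one_right : ∀ s, rep s ◁ one.hom ≫ (ψ s 1).hom ≫ eqToHom (by rw [mul_one]) =
    (ρ_ (rep s)).hom
  ψ_zero_left : ∀ t, zero.hom ▷ rep t ≫ (ψ 0 t).hom ≫ eqToHom (by rw [zero_mul]) =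
    rHat (rep t) ≫ zero.hom
  ψ_zero_right : ∀ s, rep s ◁ zero.hom ≫ (ψ s 0).hom ≫ eqToHom (by rw [mul_zero]) =
    lHat (rep s) ≫ zero.hom

theorem lHat_naturality {X Y : A} (f : X ⟶ Y) : f ▷ zeroObj A ≫ lHat Y = lHat X := by
  apply lHat_unique
  have h := distribL_naturality f (𝟙 (zeroObj A)) (𝟙 (zeroObj A))
  rw [sumHom_id, tensorHom_id, tensorHom_id] at h
  have := isIso A f
  rw [← cancel_mono (f ▷ zeroObj A), Category.assoc, Category.assoc, ← zeroSum_naturality,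
    sumHom_comp_assoc, Category.id_comp, Category.comp_id]
  have e : (f ▷ zeroObj A ≫ lHat Y) ⊕ₕ f ▷ zeroObj A =
      (f ▷ zeroObj A ⊕ₕ f ▷ zeroObj A) ≫ (lHat Y ⊕ₕ 𝟙 _) := by
    rw [← sumHom_comp, Category.comp_id]
  rw [e, Category.assoc, ← reassoc_of% h, lHat_spec, whisker_exchange]

theorem rHat_naturality {X Y : A} (f : X ⟶ Y) : zeroObj A ◁ f ≫ rHat Y = rHat X := by
  have h := distribR_naturality (𝟙 (zeroObj A)) (𝟙 (zeroObj A)) f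
  rw [sumHom_id, id_tensorHom, id_tensorHom] at h
  have := isIso A f
  have key : (distribR (zeroObj A) (zeroObj A) X).hom ≫
      ((zeroObj A ◁ f ≫ rHat Y) ⊕ₕ 𝟙 (zeroObj A ⊗ X)) ≫ (zeroSum (zeroObj A ⊗ X)).hom =
      (zeroSum (zeroObj A)).hom ▷ X := by
    rw [← cancel_mono (zeroObj A ◁ f), Category.assoc, Category.assoc, ← zeroSum_naturality,
      sumHom_comp_assoc, Category.id_comp, Category.comp_id]
    have e : (zeroObj A ◁ f ≫ rHat Y) ⊕ₕ zeroObj A ◁ f =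
        (zeroObj A ◁ f ⊕ₕ zeroObj A ◁ f) ≫ (rHat Y ⊕ₕ 𝟙 _) := by
      rw [← sumHom_comp, Category.comp_id]
    rw [e, Category.assoc, ← reassoc_of% h, rHat_spec, whisker_exchange]
  rw [← rHat_spec, cancel_epi, cancel_mono] at key
  exact (sumHom_id_bijective _ _ _).1 key

theorem lHat_one : lHat (𝟙_ A) = (λ_ (zeroObj A)).hom := by
  symm
  apply lHat_unique
  rw [← cancel_mono (λ_ (zeroObj A)).hom, Category.assoc, Category.assoc, ← zeroSum_naturality,
    sumHom_comp_assoc, Category.comp_id, Category.id_comp, reassoc_of% distribL_one,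
    leftUnitor_naturality]

theorem rHat_zero : rHat (zeroObj A) = lHat (zeroObj A) := by
  apply lHat_unique
  have h := BraidedAnnCategory.braiding_distrib (zeroObj A) (zeroObj A) (zeroObj A)
  rw [BraidedAnnCategory.braiding_zero, sumHom_id, Category.comp_id] at h
  rw [h, Category.assoc, rHat_spec, ← BraidedCategory.braiding_naturality_right,
    BraidedAnnCategory.braiding_zero, Category.comp_id]

theorem rHat_one : rHat (𝟙_ A) = (ρ_ (zeroObj A)).hom := by
  have key : (distribR (zeroObj A) (zeroObj A) (𝟙_ A)).hom ≫
      ((ρ_ (zeroObj A)).hom ⊕ₕ 𝟙 (zeroObj A ⊗ 𝟙_ A)) ≫ (zeroSum (zeroObj A ⊗ 𝟙_ A)).hom =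
      (zeroSum (zeroObj A)).hom ▷ 𝟙_ A := by
    rw [← cancel_mono (ρ_ (zeroObj A)).hom, Category.assoc, Category.assoc, ← zeroSum_naturality,
      sumHom_comp_assoc, Category.comp_id, Category.id_comp, reassoc_of% distribR_one,
      rightUnitor_naturality]
  rw [← rHat_spec, cancel_epi, cancel_mono] at key
  exact ((sumHom_id_bijective _ _ _).1 key).symm

theorem zeroSum_zeroObj {A : Type u} [Category.{v} A] [SumStructure A] :
    (zeroSum (zeroObj A)).hom = (sumZero (zeroObj A)).hom :=
  @unitors_equal A _ SumStructure.monoidal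

theorem hom_eq_of_trivial (h : (0 : Pi0 A) = 1) {X Y : A} (f g : X ⟶ Y) : f = g := by
  have := isIso A g
  rw [← cancel_mono (inv g), IsIso.hom_inv_id]
  obtain ⟨a, ha⟩ := (gamma X).surjective (f ≫ inv g)
  have h0 : a = 0 := by rw [← one_smul (Pi0 A) a, ← h, zero_smul]
  rw [← ha, h0, gamma_zero]

/-- Sticks exist. -/
theorem Stick.nonempty (A : Type u) [Category.{v} A] [MonoidalCategory A] [BraidedCategory A]
    [SumStructure A] [BraidedAnnCategory A] : Nonempty (Stick A) := by
  obtain ⟨rep, mk_rep⟩ : ∃ rep : Pi0 A → A, ∀ s, Pi0.mk (rep s) = s :=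
    ⟨fun s => Quotient.out (s := isIsomorphicSetoid A) s,
      fun s => Quotient.out_eq (s := isIsomorphicSetoid A) s⟩
  obtain ⟨zero⟩ : Nonempty (zeroObj A ≅ rep 0) := Pi0.exact (mk_rep 0).symm
  obtain ⟨one⟩ : Nonempty (𝟙_ A ≅ rep 1) := Pi0.exact (mk_rep 1).symm
  have hφ : ∀ s t, ∃ f : rep s ⊕ₐ rep t ⟶ rep (s + t),
      (∀ h : s = 0, ((zero.hom ≫ eqToHom (by rw [h])) ⊕ₕ 𝟙 (rep t)) ≫ f ≫
        eqToHom (by rw [h, zero_add]) = (zeroSum (rep t)).hom) ∧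
      (∀ h : t = 0, (𝟙 (rep s) ⊕ₕ (zero.hom ≫ eqToHom (by rw [h]))) ≫ f ≫
        eqToHom (by rw [h, add_zero]) = (sumZero (rep s)).hom) := by
    intro s t
    by_cases hs : s = 0
    · subst hs
      refine ⟨(zero.inv ⊕ₕ 𝟙 _) ≫ (zeroSum (rep t)).hom ≫ eqToHom (by rw [zero_add]), ?_, ?_⟩
      · intro _
        simp only [eqToHom_refl, Category.comp_id, Category.assoc, eqToHom_trans, sumHom_comp_assoc]
        simp
      · rintro rfl
        have := isIso A (zero.hom ⊕ₕ 𝟙 (zeroObj A))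
        rw [← cancel_epi (zero.hom ⊕ₕ 𝟙 (zeroObj A)), sumZero_naturality, ← zeroSum_zeroObj,
          ← zeroSum_naturality zero.hom]
        simp only [eqToHom_refl, Category.comp_id, Category.assoc, eqToHom_trans, sumHom_comp_assoc]
        simp
    · by_cases ht : t = 0
      · subst ht
        refine ⟨(𝟙 _ ⊕ₕ zero.inv) ≫ (sumZero (rep s)).hom ≫ eqToHom (by rw [add_zero]), ?_, ?_⟩
        · intro h
          exact absurd h hs
        · intro _
          simp only [eqToHom_refl, Category.comp_id, Category.assoc, eqToHom_trans, sumHom_comp_assoc]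
          simp
      · obtain ⟨e⟩ : Nonempty (rep s ⊕ₐ rep t ≅ rep (s + t)) := Pi0.exact (by
          rw [← Pi0.mk_add, mk_rep, mk_rep, mk_rep])
        exact ⟨e.hom, fun h => absurd h hs, fun h => absurd h ht⟩
  have hψ : ∀ s t, ∃ f : rep s ⊗ rep t ⟶ rep (s * t),
      (∀ h : s = 1, (one.hom ≫ eqToHom (by rw [h])) ▷ rep t ≫ f ≫
        eqToHom (by rw [h, one_mul]) = (λ_ (rep t)).hom) ∧
      (∀ h : t = 1, rep s ◁ (one.hom ≫ eqToHom (by rw [h])) ≫ f ≫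
        eqToHom (by rw [h, mul_one]) = (ρ_ (rep s)).hom) ∧
      (∀ h : s = 0, (zero.hom ≫ eqToHom (by rw [h])) ▷ rep t ≫ f ≫
        eqToHom (by rw [h, zero_mul]) = rHat (rep t) ≫ zero.hom) ∧
      (∀ h : t = 0, rep s ◁ (zero.hom ≫ eqToHom (by rw [h])) ≫ f ≫
        eqToHom (by rw [h, mul_zero]) = lHat (rep s) ≫ zero.hom) := by
    intro s t
    obtain ⟨e⟩ : Nonempty (rep s ⊗ rep t ≅ rep (s * t)) := Pi0.exact (by
      rw [← Pi0.mk_mul, mk_rep, mk_rep, mk_rep])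
    by_cases h01 : (0 : Pi0 A) = 1
    · exact ⟨e.hom, fun _ => hom_eq_of_trivial h01 _ _, fun _ => hom_eq_of_trivial h01 _ _,
        fun _ => hom_eq_of_trivial h01 _ _, fun _ => hom_eq_of_trivial h01 _ _⟩
    by_cases hs0 : s = 0
    · subst hs0
      refine ⟨zero.inv ▷ rep t ≫ rHat (rep t) ≫ zero.hom ≫ eqToHom (by rw [zero_mul]),
        fun h => absurd h h01, ?_, ?_, ?_⟩
      · rintro rfl
        rw [← cancel_epi (zero.hom ▷ 𝟙_ A), rightUnitor_naturality, ← rHat_one,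
          ← rHat_naturality one.hom]
        simp only [eqToHom_refl, Category.comp_id, Category.assoc, eqToHom_trans]
        rw [whisker_exchange_assoc, hom_inv_whiskerRight_assoc]
      · intro _
        simp
      · rintro rfl
        rw [← cancel_epi (zero.hom ▷ zeroObj A), reassoc_of% lHat_naturality, ← rHat_zero,
          ← rHat_naturality zero.hom]
        simp only [eqToHom_refl, Category.comp_id, Category.assoc, eqToHom_trans]
        rw [whisker_exchange_assoc, hom_inv_whiskerRight_assoc]
    by_cases hs1 : s = 1
    · subst hs1
      refine ⟨one.inv ▷ rep t ≫ (λ_ (rep t)).hom ≫ eqToHom (by rw [one_mul]), ?_, ?_,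
        fun h => absurd h hs0, ?_⟩
      · intro _
        simp
      · rintro rfl
        rw [← cancel_epi (one.hom ▷ 𝟙_ A), rightUnitor_naturality, ← unitors_equal,
          ← leftUnitor_naturality one.hom]
        simp only [eqToHom_refl, Category.comp_id, Category.assoc, eqToHom_trans]
        rw [whisker_exchange_assoc, hom_inv_whiskerRight_assoc]
      · rintro rfl
        rw [← cancel_epi (one.hom ▷ zeroObj A), reassoc_of% lHat_naturality, lHat_one,
          ← leftUnitor_naturality zero.hom]
        simp only [eqToHom_refl, Category.comp_id, Category.assoc, eqToHom_trans]
        rw [whisker_exchange_assoc, hom_inv_whiskerRight_assoc]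
    by_cases ht0 : t = 0
    · subst ht0
      exact ⟨rep s ◁ zero.inv ≫ lHat (rep s) ≫ zero.hom ≫ eqToHom (by rw [mul_zero]),
        fun h => absurd h hs1, fun h => absurd h h01, fun h => absurd h hs0, fun _ => by simp⟩
    by_cases ht1 : t = 1
    · subst ht1
      exact ⟨rep s ◁ one.inv ≫ (ρ_ (rep s)).hom ≫ eqToHom (by rw [mul_one]),
        fun h => absurd h hs1, fun _ => by simp, fun h => absurd h hs0, fun h => absurd h ht0⟩
    exact ⟨e.hom, fun h => absurd h hs1, fun h => absurd h ht1, fun h => absurd h hs0,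
      fun h => absurd h ht0⟩
  choose φ hφ1 hφ2 using hφ
  choose ψ hψ1 hψ2 hψ3 hψ4 using hψ
  exact ⟨{
    rep := rep
    mk_rep := mk_rep
    zero := zero
    one := one
    φ := fun s t => @asIso _ _ _ _ (φ s t) (isIso A _)
    ψ := fun s t => @asIso _ _ _ _ (ψ s t) (isIso A _)
    φ_zero_left := fun t => by simpa using hφ1 0 t rfl
    φ_zero_right := fun s => by simpa using hφ2 s 0 rfl
    ψ_one_left := fun t => by simpa using hψ1 1 t rfl
    ψ_one_right := fun s => by simpa using hψ2 s 1 rfl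
    ψ_zero_left := fun t => by simpa using hψ3 0 t rfl
    ψ_zero_right := fun s => by simpa using hψ4 s 0 rfl }⟩

/-- The reduced category `sA`: its objects are the elements of `π₀`. -/
@[ext]
structure Stick.Red (T : Stick A) where
  cls : Pi0 A

/-- The morphisms of the reduced category: pairs `(s, a)` with `a` in `π₁`, going from `s` to `s`. -/
@[ext]
structure Stick.Red.Hom {T : Stick A} (s t : T.Red) where
  eq : s.cls = t.cls
  val : Pi1 A

namespace Stick

variable (T : Stick A)

/-- The composition is the addition of `π₁`. -/
noncomputable instance : Category T.Red where
  Hom s t := Red.Hom s t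
  id _ := ⟨rfl, 0⟩
  comp f g := ⟨f.eq.trans g.eq, f.val + g.val⟩
  id_comp f := Red.Hom.ext (zero_add f.val)
  comp_id f := Red.Hom.ext (add_zero f.val)
  assoc f g h := Red.Hom.ext (add_assoc f.val g.val h.val)

variable {T} in
/-- The element of `π₁` of a morphism of `sA`. -/
def val {s t : T.Red} (f : s ⟶ t) : Pi1 A := Red.Hom.val f

variable {T} in
theorem cls_eq {s t : T.Red} (f : s ⟶ t) : s.cls = t.cls := Red.Hom.eq f

/-- The automorphism `(s, a)` of `s`. -/
def homMk (s : T.Red) (a : Pi1 A) : s ⟶ s := Red.Hom.mk rfl a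

/-- The functor `H : sA ⥤ A`, with `H(s) = X_s` and `H(s, a) = γ(a)`. -/
noncomputable def H : T.Red ⥤ A where
  obj s := T.rep s.cls
  map {s t} f := gamma (T.rep s.cls) (val f) ≫ eqToHom (by rw [cls_eq f])
  map_id s := by
    change gamma (T.rep s.cls) 0 ≫ _ = _
    rw [gamma_zero]
    simp
  map_comp {s t r} f g := by
    obtain ⟨s⟩ := s
    obtain ⟨t⟩ := t
    obtain ⟨r⟩ := r
    obtain ⟨h, a⟩ := f
    obtain ⟨h', b⟩ := g
    dsimp only at h h'
    subst h h'
    change gamma (T.rep s) (a + b) ≫ _ = (gamma (T.rep s) a ≫ _) ≫ (gamma (T.rep s) b ≫ _)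
    rw [gamma_add]
    simp

theorem H_map {s t : T.Red} (f : s ⟶ t) :
    T.H.map f = gamma (T.H.obj s) (val f) ≫ eqToHom (congrArg T.H.obj (Red.ext (cls_eq f))) := rfl

theorem mk_H_obj (s : T.Red) : Pi0.mk (T.H.obj s) = s.cls := T.mk_rep s.cls

theorem H_map_homMk (s : T.Red) (a : Pi1 A) : T.H.map (T.homMk s a) = gamma (T.H.obj s) a := by
  rw [H_map, eqToHom_refl, Category.comp_id]
  rfl

instance : T.H.Faithful where
  map_injective {s t} f g h := by
    rw [H_map, H_map, cancel_mono] at h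
    exact Red.Hom.ext ((gamma _).injective h)

theorem val_eq_of_map {s : T.Red} (f : s ⟶ s) {a : Pi1 A}
    (h : T.H.map f = gamma (T.H.obj s) a) : val f = a := by
  rw [← H_map_homMk] at h
  rw [T.H.map_injective h]
  rfl

instance : T.H.Full where
  map_surjective {s t} f := by
    have := isIso A f
    obtain rfl : s = t := Red.ext (by
      rw [← mk_H_obj, ← mk_H_obj]
      exact Pi0.sound (asIso f))
    exact ⟨T.homMk s ((gamma (T.H.obj s)).symm f), by
      rw [H_map_homMk, Equiv.apply_symm_apply]⟩

/-- The object `[X]` of `sA`. -/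
def cl (X : A) : T.Red := ⟨Pi0.mk X⟩

theorem cl_H_obj (s : T.Red) : T.cl (T.H.obj s) = s := Red.ext (T.mk_H_obj s)

/-- A family of isomorphisms `i_X : X ≅ X_s`, `s = [X]`, with `i_{X_s} = id`. -/
structure IsoFamily where
  iso : ∀ X : A, X ≅ T.H.obj (T.cl X)
  iso_rep : ∀ s : T.Red, iso (T.H.obj s) = eqToIso (congrArg T.H.obj (T.cl_H_obj s).symm)

open Classical in
theorem IsoFamily.nonempty : Nonempty T.IsoFamily :=
  ⟨{ iso := fun X => if h : X = T.H.obj (T.cl X) then eqToIso h else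
        (Pi0.exact (T.mk_H_obj (T.cl X)).symm).some
     iso_rep := fun s => dif_pos (congrArg T.H.obj (T.cl_H_obj s).symm) }⟩

/-- The tensor product of `sA`: `s ⊗ t = st`, with the constraints induced through `H` and `ψ`. -/
noncomputable instance : MonoidalCategory T.Red :=
  inducedMonoidal T.H (fun s t => ⟨s.cls * t.cls⟩) ⟨1⟩ T.one (fun s t => T.ψ s.cls t.cls)

/-- The braiding of `sA`, induced through `H` and `ψ`. -/
noncomputable instance : BraidedCategory T.Red :=
  inducedBraided T.H (fun s t => ⟨s.cls * t.cls⟩) ⟨1⟩ T.one (fun s t => T.ψ s.cls t.cls)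

/-- `H` is a braided functor, with structure isomorphisms `ψ`. -/
noncomputable instance : T.H.Braided :=
  inducedBraidedFunctor T.H (fun s t => ⟨s.cls * t.cls⟩) ⟨1⟩ T.one (fun s t => T.ψ s.cls t.cls)

/-- The sum of `sA`: `s ⊕ t = s + t`, with the constraints induced through `H` and `φ`. -/
noncomputable instance : SumStructure T.Red where
  monoidal := @inducedMonoidal A _ SumStructure.monoidal T.Red _ T.H _ _
    (fun s t => ⟨s.cls + t.cls⟩) ⟨0⟩ T.zero (fun s t => T.φ s.cls t.cls)
  symmetric := @inducedSymmetric A _ SumStructure.monoidal T.Red _ T.H _ _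
    (fun s t => ⟨s.cls + t.cls⟩) ⟨0⟩ T.zero (fun s t => T.φ s.cls t.cls) SumStructure.symmetric
  group := by
    let _ := @inducedMonoidal A _ SumStructure.monoidal T.Red _ T.H _ _
      (fun s t => ⟨s.cls + t.cls⟩) ⟨0⟩ T.zero (fun s t => T.φ s.cls t.cls)
    exact
    { isIso := fun f => by
        have := isIso A (T.H.map f)
        exact isIso_of_reflects_iso f T.H
      exists_inverse := fun s => ⟨⟨-s.cls⟩,
        ⟨eqToIso (Red.ext (add_neg_cancel s.cls))⟩, ⟨eqToIso (Red.ext (neg_add_cancel s.cls))⟩⟩ }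

/-- `H` is a symmetric monoidal functor for the sums, with structure isomorphisms `φ`. -/
@[reducible]
noncomputable def sumH : SumFunctor T.H :=
  @inducedBraidedFunctor A _ SumStructure.monoidal T.Red _ T.H _ _
    (fun s t => ⟨s.cls + t.cls⟩) ⟨0⟩ T.zero (fun s t => T.φ s.cls t.cls) (SumStructure.braided A)

theorem mu_H (s t : T.Red) : μ T.H s t = (T.ψ s.cls t.cls).hom := rfl

theorem sumMu_H (s t : T.Red) : sumMu T.sumH s t = (T.φ s.cls t.cls).hom := rfl

/-- The distributivity constraints of `sA`, induced through `H`, `φ` and `ψ`. -/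
noncomputable def distribTransport : DistribTransport T.H T.sumH := .ofFullyFaithful T.H T.sumH

/-- The reduced braided Ann-category `sA`. -/
noncomputable instance : BraidedAnnCategory T.Red := T.distribTransport.braidedAnnCategory

/-- The canonical braided Ann-functor `H : sA ⥤ A`, with structure isomorphisms `φ` and `ψ`. -/
noncomputable def annH : BraidedAnnFunctor T.Red A where
  functor := T.H
  add := T.sumH
  map_distribL := T.distribTransport.hL
  map_distribR := T.distribTransport.hR

theorem val_sumHom {s t s' t' : T.Red} (f : s ⟶ t) (g : s' ⟶ t') :
    val (f ⊕ₕ g) = val f + val g := by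
  obtain rfl := Red.ext (cls_eq f)
  obtain rfl := Red.ext (cls_eq g)
  apply val_eq_of_map
  have := isIso A (sumMu T.sumH s s')
  rw [← cancel_epi (sumMu T.sumH s s'), ← sumMu_naturality, H_map, H_map,
    eqToHom_refl, eqToHom_refl, Category.comp_id, Category.comp_id, gamma_sumHom_gamma,
    gamma_naturality]

theorem val_tensorHom {s t s' t' : T.Red} (f : s ⟶ t) (g : s' ⟶ t') :
    val (f ⊗ₘ g) = s.cls • val g + s'.cls • val f := by
  obtain rfl := Red.ext (cls_eq f)
  obtain rfl := Red.ext (cls_eq g)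
  apply val_eq_of_map
  rw [← cancel_epi (μ T.H s s'), ← μ_natural, H_map, H_map,
    eqToHom_refl, eqToHom_refl, Category.comp_id, Category.comp_id, gamma_tensorHom_gamma,
    mk_H_obj, mk_H_obj, gamma_naturality]

/-- The element `β(r, s)` of the braiding of `sA` is given by `ψ_{s,r} ∘ c = γ(β(r, s)) ∘ ψ_{r,s}`. -/
theorem val_braiding (r s : T.Red) :
    μ T.H r s ≫ gamma (T.H.obj (r ⊗ s)) (val (β_ r s).hom) ≫
        eqToHom (congrArg T.H.obj (Red.ext (mul_comm r.cls s.cls))) =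
      (β_ (T.H.obj r) (T.H.obj s)).hom ≫ μ T.H s r :=
  Functor.LaxBraided.braided (F := T.H) r s

theorem val_eq_zero {s t : T.Red} (f : s ⟶ t) (h : T.H.map f = eqToHom
    (congrArg T.H.obj (Red.ext (cls_eq f)))) : val f = 0 := by
  obtain rfl := Red.ext (cls_eq f)
  apply val_eq_of_map
  rw [h, gamma_zero, eqToHom_refl]

/-- The unit constraints of `sA` are strict: their elements of `π₁` are zero. -/
theorem val_zeroSum (s : T.Red) : val (zeroSum s).hom = 0 := by
  apply val_eq_zero
  have h : T.H.map (zeroSum s).hom = (T.φ 0 s.cls).inv ≫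
      (T.zero.inv ⊕ₕ 𝟙 (T.rep s.cls)) ≫ (zeroSum (T.rep s.cls)).hom := by
    refine Eq.trans (T.H.map_preimage _) ?_
    exact Category.assoc _ _ _
  rw [h, ← T.φ_zero_left, sumHom_comp_assoc, Iso.inv_hom_id, Category.comp_id, sumHom_id,
    Category.id_comp, Iso.inv_hom_id_assoc]
  rfl

theorem val_sumZero (s : T.Red) : val (sumZero s).hom = 0 := by
  apply val_eq_zero
  have h : T.H.map (sumZero s).hom = (T.φ s.cls 0).inv ≫
      (𝟙 (T.rep s.cls) ⊕ₕ T.zero.inv) ≫ (sumZero (T.rep s.cls)).hom := by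
    refine Eq.trans (T.H.map_preimage _) ?_
    exact Category.assoc _ _ _
  rw [h, ← T.φ_zero_right, sumHom_comp_assoc, Iso.inv_hom_id, Category.comp_id, sumHom_id,
    Category.id_comp, Iso.inv_hom_id_assoc]
  rfl

theorem val_leftUnitor (s : T.Red) : val (λ_ s).hom = 0 := by
  apply val_eq_zero
  have h : T.H.map (λ_ s).hom = (T.ψ 1 s.cls).inv ≫
      (T.one.inv ⊗ₘ 𝟙 (T.rep s.cls)) ≫ (λ_ (T.rep s.cls)).hom := by
    refine Eq.trans (T.H.map_preimage _) ?_
    exact Category.assoc _ _ _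
  rw [h, ← T.ψ_one_left, tensorHom_id, inv_hom_whiskerRight_assoc, Iso.inv_hom_id_assoc]
  rfl

theorem val_rightUnitor (s : T.Red) : val (ρ_ s).hom = 0 := by
  apply val_eq_zero
  have h : T.H.map (ρ_ s).hom = (T.ψ s.cls 1).inv ≫
      (𝟙 (T.rep s.cls) ⊗ₘ T.one.inv) ≫ (ρ_ (T.rep s.cls)).hom := by
    refine Eq.trans (T.H.map_preimage _) ?_
    exact Category.assoc _ _ _
  rw [h, ← T.ψ_one_right, id_tensorHom, whiskerLeft_inv_hom_assoc, Iso.inv_hom_id_assoc]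
  rfl

variable {T} (i : T.IsoFamily)

/-- The functor `G : A ⥤ sA`, with `G(X) = [X]` and `G(f) = (s, γ⁻¹(i_Y ∘ f ∘ i_X⁻¹))`, i.e.
`H(G(f)) = i_Y ∘ f ∘ i_X⁻¹`. -/
noncomputable def IsoFamily.G : A ⥤ T.Red where
  obj X := T.cl X
  map {X Y} f := T.H.preimage ((i.iso X).inv ≫ f ≫ (i.iso Y).hom)
  map_id X := T.H.map_injective (by simp)
  map_comp f g := T.H.map_injective (by simp)

theorem IsoFamily.H_map_G_map {X Y : A} (f : X ⟶ Y) :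
    T.H.map (i.G.map f) = (i.iso X).inv ≫ f ≫ (i.iso Y).hom := T.H.map_preimage _

/-- The isomorphisms `id ≅ G ∘ H` given by `i`. -/
noncomputable def IsoFamily.unit : 𝟭 T.Red ≅ T.H ⋙ i.G :=
  NatIso.ofComponents (fun s => T.H.preimageIso (i.iso (T.H.obj s)))
    (fun f => T.H.map_injective (by
      have h : ∀ s : T.Red, T.H.map (T.H.preimageIso (i.iso (T.H.obj s))).hom =
        (i.iso (T.H.obj s)).hom := fun s => T.H.map_preimage _
      refine (T.H.map_comp _ _).trans (Eq.trans ?_ (T.H.map_comp _ _).symm)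
      refine (congrArg (_ ≫ ·) (h _)).trans
        (Eq.trans ?_ (congrArg₂ (· ≫ ·) (h _) (i.H_map_G_map _)).symm)
      exact ((i.iso _).hom_inv_id_assoc _).symm))

/-- The isomorphisms `H ∘ G ≅ id` given by `i⁻¹`. -/
noncomputable def IsoFamily.counit : i.G ⋙ T.H ≅ 𝟭 A :=
  NatIso.ofComponents (fun X => (i.iso X).symm) (fun {X Y} f => by
    refine Eq.trans (congrArg (· ≫ (i.iso Y).inv) (i.H_map_G_map f)) ?_
    exact show ((i.iso X).inv ≫ f ≫ (i.iso Y).hom) ≫ (i.iso Y).inv = (i.iso X).inv ≫ f by simp)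

/-- The canonical braided Ann-functor `G : A ⥤ sA`, inverse to `H`: its structure of braided
Ann-functor is the one for which the isomorphisms `i_X` are monoidal for `⊕` and for `⊗`. -/
noncomputable def IsoFamily.annG : BraidedAnnFunctor A T.Red :=
  T.annH.inverse i.G i.unit i.counit (fun s => by
    change T.H.map (T.H.preimage (i.iso (T.H.obj s)).hom) ≫ (i.iso (T.H.obj s)).inv = 𝟙 _
    simp)

/-- `K` is a functor of type `(p, q)`: `K(s) = p(s)` and `K(s, a) = (p(s), q(a))`, where the ring
homomorphism `p` and the group homomorphism `q` satisfy `q(sa) = p(s)q(a)`. -/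
def IsOfType {B : Type u₂} [Category.{v₂} B] [MonoidalCategory B] [BraidedCategory B]
    [SumStructure B] [BraidedAnnCategory B] {T' : Stick B} (K : T.Red ⥤ T'.Red)
    (p : Pi0 A →+* Pi0 B) (q : Pi1 A →+ Pi1 B) : Prop :=
  (∀ s a, q (s • a) = p s • q a) ∧ (∀ s, (K.obj s).cls = p s.cls) ∧
    ∀ {s t} (f : s ⟶ t), val (K.map f) = q (val f)

end Stick

end Reduced

end BrAnn

/-! A braided Ann-category is a groupoid in which every endomorphism of an object `X` equals `gamma
X u` for exactly one `u` in `π₁`. Up to the choice of one isomorphism between isomorphic objects, a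
morphism is therefore an element of `π₁`, and a functor is controlled by its effect on isomorphism
classes and on the automorphisms `gamma X u`.

The central lemma is `map_gamma`: `F` carries `gamma X u` to `gamma (F X) (F₁ u)` for every `X`,
although `F₁` is defined from the object `0` alone. It holds because `gamma` commutes with all
morphisms and `gamma (X ⊕ Y) u` is `gamma X u ⊕ id`, while the structure maps of `F` for `⊕` are
natural. Equivariance (`mapPi1_smul`) follows from the same principle for `⊗`, since tensoring
`gamma Y u` with `X` on the left gives `gamma (X ⊗ Y) ([X] • u)`. That `F₀` is a ring homomorphism
is the existence of the structure isomorphisms of `F`.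

For the reduced functor, `G'` conjugates by the isomorphisms `i'`, and conjugation does not change
the element of `π₁` because `gamma` is natural. Hence `G' ∘ F ∘ H` sends `(s, u)` to `(F₀ s, F₁ u)`,
which is `isOfType_comp`.

For the criterion, bijectivity of `F₀` and `F₁` has to be compared with `F` being full, faithful and
essentially surjective. Surjectivity of `F₀` is essential surjectivity, injectivity of `F₁` gives
faithfulness, and fullness uses injectivity of `F₀` together with surjectivity of `F₁`. The two
notions of equivalence agree because a quasi-inverse inherits the whole structure: in an adjoint
equivalence, the structure maps of `F` determine those of the inverse in such a way that unit and
counit become monoidal (`isAnnEquivalence_iff_isEquivalence`). -/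

namespace BrAnn

/-! ### Monoidality of the unit and counit of a braided equivalence. -/

section Generic

variable {C : Type u₁} [Category.{v₁} C] [MonoidalCategory C] [BraidedCategory C]
  {D : Type u₂} [Category.{v₂} D] [MonoidalCategory D] [BraidedCategory D]

/-- The unit and the counit of an equivalence are monoidal for the inverse braided structure; the
unit is stated in the direction `inverse ∘ functor ⟶ id`. -/
theorem isMonoidal_unitInv_counit (e : C ≌ D) (h : e.functor.Braided) :
    letI := inverseBraided e h
    NatTrans.IsMonoidal e.unitInv ∧ NatTrans.IsMonoidal e.counit := by
  -- The monoidal structure underlying `inverseBraided e h` is by definition `e.inverseMonoidal`,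
  -- the one which makes the adjunction of `e` monoidal. Only this part matters for the conclusion.
  let _ : e.inverse.Monoidal := e.inverseMonoidal
  have _ : e.IsMonoidal := e.toAdjunction.instIsMonoidal
  have _ : NatTrans.IsMonoidal e.unitIso.hom := inferInstanceAs (NatTrans.IsMonoidal e.unit)
  -- The inverse of a monoidal natural isomorphism is monoidal, which turns the unit around.
  exact ⟨inferInstanceAs (NatTrans.IsMonoidal e.unitIso.inv), inferInstance⟩

end Generic

/-! ### Braided Ann-equivalences versus equivalences of underlying categories. -/

namespace BraidedAnnFunctor

open Functor.LaxMonoidal AnnCategory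

variable {A : Type u₁} [Category.{v₁} A] [MonoidalCategory A] [BraidedCategory A]
  [SumStructure A] [BraidedAnnCategory A]
  {B : Type u₂} [Category.{v₂} B] [MonoidalCategory B] [BraidedCategory B]
  [SumStructure B] [BraidedAnnCategory B] (F : BraidedAnnFunctor A B)

/-- One direction forgets structure. For the other, an adjoint inverse carries a unique way of being
monoidal compatibly with the counit, for `⊕` and for `⊗` separately; compatibility with the
distributivity constraints then passes from `F` to the inverse, because it can be tested after
applying the faithful functor `F`. Thus no condition beyond equivalence of categories remains, and
the criterion in terms of `F₀` and `F₁` has to be proved for one notion only. -/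
theorem isAnnEquivalence_iff_isEquivalence : F.IsAnnEquivalence ↔ F.functor.IsEquivalence := by
  constructor
  · rintro ⟨K, η, θ, -, -⟩
    -- The given `η` and `θ` need not satisfy a triangle identity; `Equivalence.mk` corrects the
    -- unit so that they do.
    exact (CategoryTheory.Equivalence.mk F.functor K.functor η.symm θ).isEquivalence_functor
  · intro _
    let e : A ≌ B := F.functor.asEquivalence
    -- The same lemma serves both operations. For `⊕` the structures are passed explicitly, since
    -- instance search would select `⊗`.
    have sum := @isMonoidal_unitInv_counit A _ SumStructure.monoidal (SumStructure.braided A)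
      B _ SumStructure.monoidal (SumStructure.braided B) e F.add
    have mul := isMonoidal_unitInv_counit e F.mul
    -- The triangle identity is what `BraidedAnnFunctor.inverse` needs. The unit is reversed because
    -- an Ann-equivalence asks for a morphism from `K ∘ F` to the identity.
    exact ⟨F.inverse e.inverse e.unitIso e.counitIso e.functor_unitIso_comp, e.unitIso.symm,
      e.counitIso, ⟨sum.1, mul.1⟩, ⟨sum.2, mul.2⟩⟩

/-! ### The induced maps on `π₀` and `π₁`. -/

/-- The ring homomorphism `F₀ : π₀ A → π₀ B`, `[X] ↦ [F X]`. -/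
noncomputable def mapPi0 : Pi0 A →+* Pi0 B where
  toFun := Quotient.map (sa := isIsomorphicSetoid A) (sb := isIsomorphicSetoid B) F.functor.obj
    (fun _ _ ⟨e⟩ => ⟨F.functor.mapIso e⟩)
  map_one' := (Pi0.sound (Functor.Monoidal.εIso F.functor)).symm
  map_mul' s t := by
    induction s using Pi0.ind; induction t using Pi0.ind
    exact (Pi0.sound (Functor.Monoidal.μIso F.functor _ _)).symm
  -- For the sums, the structure maps of `F` are invertible simply because `B` is a groupoid.
  map_zero' := (Pi0.sound (@asIso _ _ _ _ (sumEps F.add) (isIso B _))).symm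
  map_add' s t := by
    induction s using Pi0.ind; induction t using Pi0.ind
    exact (Pi0.sound (@asIso _ _ _ _ (sumMu F.add _ _) (isIso B _))).symm

theorem mapPi0_mk (X : A) : F.mapPi0 (Pi0.mk X) = Pi0.mk (F.functor.obj X) := rfl

/-- The group homomorphism `F₁ : π₁ A → π₁ B`, `u ↦ γ⁻¹(F u)`. -/
noncomputable def mapPi1 : Pi1 A →+ Pi1 B where
  -- `F u` is an automorphism of `F 0`, not of `0`; reading it through `gamma` at `F 0` replaces
  -- conjugation by an isomorphism between `0` and `F 0`.
  toFun u := (gamma (F.functor.obj (zeroObj A))).symm (F.functor.map u.hom)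
  map_zero' := by rw [Equiv.symm_apply_eq, gamma_zero, Pi1.hom_zero, F.functor.map_id]
  map_add' a b := by
    rw [Equiv.symm_apply_eq, gamma_add, Equiv.apply_symm_apply, Equiv.apply_symm_apply,
      Pi1.hom_add, F.functor.map_comp]

theorem mapPi1_apply (u : Pi1 A) :
    F.mapPi1 u = (gamma (F.functor.obj (zeroObj A))).symm (F.functor.map u.hom) := rfl

theorem map_hom (u : Pi1 A) :
    F.functor.map u.hom = gamma (F.functor.obj (zeroObj A)) (F.mapPi1 u) := by
  rw [mapPi1_apply, Equiv.apply_symm_apply]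

/-- This extends the defining property of `F₁` from the object `0` to all objects, and everything
below rests on it. Both sides are compared along the composite `F 0 ⊕ F X ⟶ F (0 ⊕ X) ⟶ F X`. On its
source each becomes `F u ⊕ id`: on the left by naturality of `sumMu`, on the right because `gamma (F
0) (F₁ u)` is `F u`. Since `gamma` commutes with every morphism, no coherence between `sumMu` and
the unit isomorphism `0 ⟶ F 0` enters. -/
theorem map_gamma (X : A) (u : Pi1 A) :
    F.functor.map (gamma X u) = gamma (F.functor.obj X) (F.mapPi1 u) := by
  have := isIso B (sumMu F.add (zeroObj A) X ≫ F.functor.map (zeroSum X).hom)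
  rw [← cancel_epi (sumMu F.add (zeroObj A) X ≫ F.functor.map (zeroSum X).hom),
    -- `gamma` is moved to the source twice: in `B` past the whole composite, and in `A` past the
    -- unit constraint inside `F`. There `gamma_sumHom_id` places it on the first summand alone.
    ← gamma_naturality, Category.assoc, ← F.functor.map_comp, ← gamma_naturality,
    F.functor.map_comp, ← gamma_sumHom_id, gamma_zeroObj, ← gamma_sumHom_id, ← map_hom,
    ← F.functor.map_id, ← Category.assoc, ← sumMu_naturality, Category.assoc]

/-- The action of `[X]` on `u` is visible as the morphism `X ◁ u`, and `F` preserves such morphisms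
up to `μ`. Both sides are therefore compared on `F (X ⊗ 0)`, where `gamma` is injective. -/
theorem mapPi1_smul (s : Pi0 A) (u : Pi1 A) : F.mapPi1 (s • u) = F.mapPi0 s • F.mapPi1 u := by
  induction s using Pi0.ind with
  | h X =>
    apply (gamma (F.functor.obj (X ⊗ zeroObj A))).injective
    rw [← map_gamma, ← whiskerLeft_gamma', gamma_zeroObj]
    -- After `μ` is pulled out, the object is `F X ⊗ F 0` rather than `F X ⊗ 0`. This is harmless,
    -- as `whiskerLeft_gamma'` computes the action on `gamma Y` for every `Y`.
    rw [← cancel_epi (μ F.functor X (zeroObj A)), ← μ_natural_right, map_hom, whiskerLeft_gamma',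
      gamma_naturality, mapPi0_mk]

/-! ### The criterion for equivalence in terms of `F₀` and `F₁`. -/

theorem mapPi0_bijective [F.functor.IsEquivalence] : Function.Bijective F.mapPi0 := by
  constructor
  · intro s t h
    induction s using Pi0.ind; induction t using Pi0.ind
    obtain ⟨e⟩ := Pi0.exact h
    exact Pi0.sound (F.functor.preimageIso e)
  · intro s
    induction s using Pi0.ind with
    | h Y => exact ⟨Pi0.mk (F.functor.objPreimage Y), Pi0.sound (F.functor.objObjPreimageIso Y)⟩

/-- Under the bijections `gamma` at `0` and at `F 0`, the map `F₁` is the action of `F` on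
endomorphisms of `0`. Faithfulness makes it injective and fullness makes it surjective. -/
theorem mapPi1_bijective [F.functor.IsEquivalence] : Function.Bijective F.mapPi1 := by
  constructor
  · intro a b h
    apply (gamma (zeroObj A)).injective
    apply F.functor.map_injective
    rw [map_gamma, map_gamma, h]
  · intro b
    obtain ⟨a, ha⟩ := (gamma (zeroObj A)).surjective
      (F.functor.preimage (gamma (F.functor.obj (zeroObj A)) b))
    refine ⟨a, (gamma (F.functor.obj (zeroObj A))).injective ?_⟩
    rw [← map_gamma, ha, F.functor.map_preimage]

/-- In a groupoid, two parallel morphisms differ by an automorphism, that is, by an element of `π₁`.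
Faithfulness and fullness thus reduce to `F₁` once it is known which hom-sets are nonempty, and
injectivity of `F₀` settles that: objects with isomorphic images are isomorphic. -/
theorem isEquivalence_of_bijective (hp : Function.Bijective F.mapPi0)
    (hq : Function.Bijective F.mapPi1) : F.functor.IsEquivalence where
  faithful := ⟨fun {X Y} f g h => by
    have := isIso A g
    -- The element `a` measures the difference of `f` and `g`. Its image under `F₁` is zero because
    -- `F f = F g`.
    obtain ⟨a, ha⟩ := (gamma X).surjective (f ≫ inv g)
    have h1 : gamma (F.functor.obj X) (F.mapPi1 a) = gamma (F.functor.obj X) 0 := by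
      rw [← map_gamma, ha, F.functor.map_comp, h, ← F.functor.map_comp, IsIso.hom_inv_id,
        F.functor.map_id, gamma_zero]
    rw [(map_eq_zero_iff F.mapPi1 hq.1).1 ((gamma _).injective h1), gamma_zero] at ha
    rw [← cancel_mono (inv g), ← ha, IsIso.hom_inv_id]⟩
  full := ⟨fun {X Y} f => by
    have := isIso B f
    -- The isomorphism `e : X ≅ Y` has the right ends but need not lift `f`.
    obtain ⟨e⟩ := Pi0.exact (hp.1 (Pi0.sound (asIso f) : F.mapPi0 (Pi0.mk X) = F.mapPi0 (Pi0.mk Y)))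
    -- The error between `f` and `F e` is an automorphism of `F X`; its element of `π₁` comes from
    -- some `a` by surjectivity of `F₁`, and `gamma X a` corrects `e`.
    obtain ⟨b, hb⟩ := (gamma (F.functor.obj X)).surjective (f ≫ F.functor.map e.inv)
    obtain ⟨a, rfl⟩ := hq.2 b
    refine ⟨gamma X a ≫ e.hom, ?_⟩
    rw [F.functor.map_comp, map_gamma, hb, Category.assoc, ← F.functor.map_comp, e.inv_hom_id,
      F.functor.map_id, Category.comp_id]⟩
  essSurj := ⟨fun Y => by
    obtain ⟨s, hs⟩ := hp.2 (Pi0.mk Y)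
    induction s using Pi0.ind with
    | h X => exact ⟨X, Pi0.exact hs⟩⟩

theorem isEquivalence_iff_bijective : F.functor.IsEquivalence ↔
    Function.Bijective F.mapPi0 ∧ Function.Bijective F.mapPi1 :=
  ⟨fun _ => ⟨F.mapPi0_bijective, F.mapPi1_bijective⟩,
    fun h => F.isEquivalence_of_bijective h.1 h.2⟩

end BraidedAnnFunctor

/-! ### The canonical equivalences `H` and `G`, and the type of the reduced functor. -/

namespace Stick

variable {A : Type u₁} [Category.{v₁} A] [MonoidalCategory A] [BraidedCategory A]
  [SumStructure A] [BraidedAnnCategory A]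
  {B : Type u₂} [Category.{v₂} B] [MonoidalCategory B] [BraidedCategory B]
  [SumStructure B] [BraidedAnnCategory B]

/-- A family `i` is needed only to exhibit a quasi-inverse of `H`, and any choice will do. The
monoidality of the resulting isomorphisms comes from `isAnnEquivalence_iff_isEquivalence`. -/
theorem annH_isAnnEquivalence (T : Stick A) : T.annH.IsAnnEquivalence := by
  obtain ⟨i⟩ := IsoFamily.nonempty T
  exact T.annH.isAnnEquivalence_iff_isEquivalence.2
    (CategoryTheory.Equivalence.mk T.H i.G i.unit i.counit).isEquivalence_functor

theorem IsoFamily.annG_isAnnEquivalence {T : Stick A} (i : T.IsoFamily) :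
    i.annG.IsAnnEquivalence :=
  i.annG.isAnnEquivalence_iff_isEquivalence.2
    (CategoryTheory.Equivalence.mk T.H i.G i.unit i.counit).isEquivalence_inverse

/-- On objects, `X_s` represents `s`, so its image has class `F₀ s`. On morphisms, `H` produces
`gamma (val f)`, `F` turns it into `gamma (F₁ (val f))` by `map_gamma`, and the conjugation by `i'`
performed by `G'` leaves the element of `π₁` unchanged. -/
theorem isOfType_comp (F : BraidedAnnFunctor A B) (T : Stick A) (T' : Stick B)
    (i' : T'.IsoFamily) :
    IsOfType ((T.annH.comp F).comp i'.annG).functor F.mapPi0 F.mapPi1 := by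
  refine ⟨F.mapPi1_smul, fun s => ?_, fun {s t} f => ?_⟩
  · change F.mapPi0 (Pi0.mk (T.H.obj s)) = _
    rw [mk_H_obj]
  -- A morphism of the reduced category has equal ends. Identifying them makes the transport
  -- `eqToHom` in `H_map` an identity.
  · obtain rfl := Red.ext (cls_eq f)
    -- The element of `π₁` is read off after applying the faithful functor `H'` of the second stick,
    -- because `G'` is known through the composite `H' ∘ G'`.
    apply val_eq_of_map
    refine (i'.H_map_G_map (F.functor.map (T.H.map f))).trans ?_
    rw [H_map, eqToHom_refl, Category.comp_id, F.map_gamma, gamma_naturality,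
      Iso.inv_hom_id_assoc]
    rfl

end Stick

end BrAnn

/-! ### The main theorem. -/

/-- The first two clauses determine `p` and `q`, since every element of `π₀` is the class of an
object. The existential therefore speaks of `F₀` and `F₁` themselves, and the existence of `p`
contains the well-definedness of `[X] ↦ [F X]`. -/
theorem mainTheorem8
    {A : Type u₁} [Category.{v₁} A] [MonoidalCategory A] [BraidedCategory A]
    [BrAnn.SumStructure A] [BrAnn.BraidedAnnCategory A]
    {A' : Type u₂} [Category.{v₂} A'] [MonoidalCategory A'] [BraidedCategory A']
    [BrAnn.SumStructure A'] [BrAnn.BraidedAnnCategory A']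
    (F : BrAnn.BraidedAnnFunctor A A') :
    ∃ (p : BrAnn.Pi0 A →+* BrAnn.Pi0 A') (q : BrAnn.Pi1 A →+ BrAnn.Pi1 A'),
      (∀ X : A, p (BrAnn.Pi0.mk X) = BrAnn.Pi0.mk (F.functor.obj X)) ∧
      (∀ u : BrAnn.Pi1 A, q u =
        (BrAnn.gamma (F.functor.obj (BrAnn.zeroObj A))).symm (F.functor.map u.hom)) ∧
      (∀ (s : BrAnn.Pi0 A) (u : BrAnn.Pi1 A), q (s • u) = p s • q u) ∧
      (∀ (T : BrAnn.Stick A) (T' : BrAnn.Stick A') (i' : T'.IsoFamily),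
        ∃ sF : BrAnn.BraidedAnnFunctor T.Red T'.Red,
          sF = (T.annH.comp F).comp i'.annG ∧ BrAnn.Stick.IsOfType sF.functor p q ∧
          T.annH.IsAnnEquivalence ∧ i'.annG.IsAnnEquivalence) ∧
      (F.IsAnnEquivalence ↔ Function.Bijective p ∧ Function.Bijective q) ∧
      (F.functor.IsEquivalence ↔ Function.Bijective p ∧ Function.Bijective q) := by
  refine ⟨F.mapPi0, F.mapPi1, F.mapPi0_mk, F.mapPi1_apply, F.mapPi1_smul, fun T T' i' => ?_,
    F.isAnnEquivalence_iff_isEquivalence.trans F.isEquivalence_iff_bijective,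
    F.isEquivalence_iff_bijective⟩
  -- The witness is the composite itself, so the equality holds for all structure maps and not only
  -- for the underlying functors.
  exact ⟨_, rfl, BrAnn.Stick.isOfType_comp F T T' i', T.annH_isAnnEquivalence,
    i'.annG_isAnnEquivalence⟩
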